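/- **Setting.** Let $P(z)=z^2+4z$, $\mathcal R=\mathbb C[t,t^{-1},u\mid u^2=t^2+4t]$ and $D=(t+2)\frac{\partial}{\partial u}+u\frac{\partial}{\partial t}$. The 3-point Witt algebra $\mathfrak W=\mathrm{Der}_{\mathbb C}\mathcal R$ has the basis $d_n=t^nuD$, $d^1_n=t^nD$ ($n\in\mathbb Z$). Let $\phi_1,\phi_2$ be the skew-symmetric bilinear forms on $\mathfrak W$ with $$\phi_1(d^1_k,d^1_l)=2(l^2-l)(2l-1)\delta_{k+l,1}+(l^3-l)\delta_{k+l,0},$$ $$\phi_1(d_k,d_l)=l(l+1)(l+2)\delta_{k+l,-2}+4l(2l+1)(l+1)\delta_{k+l,-1}+4l(2l-1)(2l+1)\delta_{k+l,0},$$ $$\phi_1(d^1_k,d_l)=6(-1)^{k+l}2^{k+l}(k-1)kl\,\frac{(2k+2l-3)!!}{(k+l+1)!}$$ (where $1/j!=0$ for $j<0$, and $(-1)!!=1$, $(-3)!!=-1$, $(-5)!!=\tfrac13$), and $\phi_2=-2\phi_1$ on pairs $(d^1_k,d^1_l)$ and $(d_k,d_l)$, $\phi_2(d^1_k,d_l)=0$.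 The 3-point Virasoro algebra is the central extension $\mathfrak V=\mathfrak W\oplus\mathbb Cc_1\oplus\mathbb Cc_2$ with $[x,y]_{\mathfrak V}=[x,y]_{\mathfrak W}+\phi_1(x,y)c_1+\phi_2(x,y)c_2$ for $x,y\in\mathfrak W$. Write $\mathbf d_m,\mathbf d^1_m$ for $d_m,d^1_m$ viewed in $\mathfrak V$, and put $\bar c=c_1-2c_2$, $\bar{\mathbf d}_m=-\mathbf d_{m+1}$, $\bar{\mathbf d}^1_m=-\mathbf d^1_{m+1}$, $\bar{\mathbf d}(z)=\sum_m\bar{\mathbf d}_mz^{-m-2}$, $\bar{\mathbf d}^1(z)=\sum_m\bar{\mathbf d}^1_mz^{-m-2}$. Let $r\in\{0,1\}$, $\kappa_0,\nu,B_0\in\mathbb C$ and $B^1_{ij}\in\mathbb C$ ($i,j\in\{0,1\}$) with $\kappa_0\ne0$ and $B^1_{00}=B^1_{11}$. Let $\mathcal F=\mathbb C[\mathbf x]\otimes\mathbb C[\mathbf y]\otimes\mathcal V$, where $\mathbb C[\mathbf x]=\mathbb C[x_n,x^1_n\mid n\in\mathbb Z]$, $\mathbb C[\mathbf y]=\mathbb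 C[y_n,y^1_n\mid n<0]$ and $\mathcal V=\mathbb C\mathbf v_0\oplus\mathbb C\mathbf v_1$. Define operators on $\mathcal F$ as follows. * $a_m=\partial/\partial x_m$ if $m\ge0$ and $r=0$, and $a_m=x_m$ otherwise; $a^*_m=x_{-m}$ if $m\le0$ and $r=0$, and $a^*_m=-\partial/\partial x_{-m}$ otherwise; $a^1_m,a^{1*}_m$ are defined in the same way with $x^1$ in place of $x$. * $b_n=y_n$ for $n<0$, $b_0=B_0$, $b_n=-2n\kappa_0\,\partial/\partial y_{-n}$ for $n>0$. * $b^1_n=y^1_n$ for $n<0$; $b^1_n=-(2+2n)\kappa_0\,\partial/\partial y^1_{-2-n}-4(1+2n)\kappa_0\,\partial/\partial y^1_{-1-n}$ for $n>0$; and $b^1_0=-2\kappa_0\,\partial/\partial y^1_{-2}-4\kappa_0\,\partial/\partial y^1_{-1}+B^1$, where $B^1\mathbf v_i=B^1_{i0}\mathbf v_0+B^1_{i1}\mathbf v_1$. (So the central element $\mathbf 1_0$ of the 3-point Heisenberg algebra acts by $\kappa_0$ and $\mathbf 1_1$ by $\chi_1=0$.) Put $\alpha(z)=\sum a_nz^{-n-1}$,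 $\alpha^*(z)=\sum a^*_nz^{-n}$, $\alpha^1(z)=\sum a^1_nz^{-n-1}$, $\alpha^{1*}(z)=\sum a^{1*}_nz^{-n}$, $\beta(z)=\sum b_nz^{-n-1}$, $\beta^1(z)=\sum b^1_nz^{-n-1}$. Normal ordered products are $:\!A(z)B(z)\!:\;=A(z)_+B(z)+B(z)A(z)_-$, where $A(z)_-$ is the part of $A(z)$ with negative powers of $z$ and $A(z)_+=A(z)-A(z)_-$; except that for $r=1$ one takes $A(z)_-=0$ for $A=\alpha,\alpha^1$. Put $$\pi(d)(z)=P(:\!\alpha\,\partial\alpha^*\!:+:\!\alpha^1\partial\alpha^{1*}\!:)+\tfrac12P'\,:\!\alpha^1\alpha^{1*}\!:,\qquad \pi(d^1)(z)=\,:\!\alpha^1\partial\alpha^*\!:+P:\!\alpha\,\partial\alpha^{1*}\!:+\tfrac12P'\,:\!\alpha\,\alpha^{1*}\!:.$$ **Theorem.** Suppose $\nu^2=\frac1{4\kappa_0^2}$. Then all the normal ordered products $:\!\alpha^i\alpha^{j*}\!:$, $:\!\alpha^i\partial\alpha^{j*}\!:$ ($\alpha^i\in\{\alpha,\alpha^1\}$,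 $\alpha^{j*}\in\{\alpha^*,\alpha^{1*}\}$), $:\!\beta^2\!:$, $:\!(\beta^1)^2\!:$, $:\!\beta\beta^1\!:$ are well defined (each coefficient is a sum of operators of which only finitely many act non-trivially on any given vector of $\mathcal F$), and there is exactly one representation $\pi$ of $\mathfrak V$ on $\mathcal F$ with $$\pi(\bar{\mathbf d})(z)=\pi(d)(z)+\gamma:\!\beta(z)^2\!:+\mu\,\partial_z\beta(z)+\gamma_1:\!(\beta^1(z))^2\!:+\gamma_2\beta(z),\qquad \pi(\bar{\mathbf d}^1)(z)=\pi(d^1)(z)+\nu:\!\beta(z)\beta^1(z)\!:+\zeta\,\partial_z\beta^1(z),$$ $$\pi(\bar c)=-\tfrac13\left(\delta_{r,0}+\tfrac12\right),\qquad \pi(c_1)=0,$$ where $\gamma=-\frac{P(z)}{4\kappa_0}$, $\gamma_1=-\frac1{4\kappa_0}$ and $\mu=\zeta=\gamma_2=0$. -/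

import Mathlib

namespace ThreePoint

open LaurentPolynomial

noncomputable section

/-- The polynomial `P = t² + 4t`. -/
def P : Polynomial ℂ := Polynomial.X ^ 2 + 4 * Polynomial.X

/-- The Laurent polynomial `t² + 4t`. -/
def PL : ℂ[T;T⁻¹] := T 2 + 4 * T 1

/-- The three-point ring `ℂ[t, t⁻¹, u | u² = t² + 4t]`: an element `⟨f, g⟩` is `f + g u`. -/
abbrev ThreePointRing : Type := QuadraticAlgebra ℂ[T;T⁻¹] PL 0

/-- The element `t ^ n`. -/
def tPow (n : ℤ) : ThreePointRing := ⟨T n, 0⟩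

/-- The element `u`. -/
def u : ThreePointRing := ⟨0, 1⟩

theorem tPow_zero : tPow 0 = 1 := by
  ext1 <;> simp [tPow, QuadraticAlgebra.re_one, QuadraticAlgebra.im_one]

theorem tPow_mul (m n : ℤ) : tPow m * tPow n = tPow (m + n) := by
  ext1
  · simp only [tPow, QuadraticAlgebra.re_mul, T_add]; ring
  · simp only [tPow, QuadraticAlgebra.im_mul]; ring

theorem u_mul_u : u * u = tPow 2 + 4 * tPow 1 := by
  have h : PL = T 2 + 4 * T 1 := rfl
  ext1
  · simp only [u, tPow, QuadraticAlgebra.re_mul, QuadraticAlgebra.re_add,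
      QuadraticAlgebra.re_ofNat, QuadraticAlgebra.im_ofNat]
    rw [h]; ring
  · simp only [u, tPow, QuadraticAlgebra.im_mul, QuadraticAlgebra.im_add,
      QuadraticAlgebra.re_ofNat, QuadraticAlgebra.im_ofNat]
    ring

/-- The derivation `d/dt` of the Laurent polynomials, first as a linear map. -/
def ddtLin : ℂ[T;T⁻¹] →ₗ[ℂ] ℂ[T;T⁻¹] :=
  (AddMonoidAlgebra.basis ℤ ℂ).constr ℂ fun n => (n : ℂ) • T (n - 1)

theorem laurent_basis (n : ℤ) : (AddMonoidAlgebra.basis ℤ ℂ n : ℂ[T;T⁻¹]) = T n := by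
  rw [AddMonoidAlgebra.basis_apply]; rfl

theorem ddtLin_T (n : ℤ) : ddtLin (T n) = (n : ℂ) • T (n - 1) := by
  rw [← laurent_basis n, ddtLin, Module.Basis.constr_basis]

theorem ddtLin_mul (f g : ℂ[T;T⁻¹]) : ddtLin (f * g) = f * ddtLin g + g * ddtLin f := by
  have key : (LinearMap.mul ℂ ℂ[T;T⁻¹]).compr₂ ddtLin =
      (LinearMap.mul ℂ ℂ[T;T⁻¹]).compl₂ ddtLin
        + ((LinearMap.mul ℂ ℂ[T;T⁻¹]).compl₂ ddtLin).flip := by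
    refine (AddMonoidAlgebra.basis ℤ ℂ).ext fun m => (AddMonoidAlgebra.basis ℤ ℂ).ext fun n => ?_
    simp only [laurent_basis, LinearMap.compr₂_apply, LinearMap.add_apply, LinearMap.compl₂_apply,
      LinearMap.flip_apply, LinearMap.mul_apply', ← T_add, ddtLin_T, mul_smul_comm]
    rw [show m + (n - 1) = m + n - 1 by ring, show n + (m - 1) = m + n - 1 by ring, ← add_smul]
    push_cast
    rw [add_comm (m : ℂ)]
  exact congrArg (fun F => F f g) key

/-- The derivation `d/dt` of the Laurent polynomials. -/
def ddt : Derivation ℂ ℂ[T;T⁻¹] ℂ[T;T⁻¹] := Derivation.mk' ddtLin fun f g => by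
  simpa using ddtLin_mul f g

theorem ddt_T (n : ℤ) : ddt (T n) = (n : ℂ) • T (n - 1) := ddtLin_T n

theorem ddt_PL : ddt PL = 2 * (T 1 + 2) := by
  have h4 : (4 : ℂ[T;T⁻¹]) = C 4 := (map_ofNat C 4).symm
  have h2 : (2 : ℂ[T;T⁻¹]) = C 2 := (map_ofNat C 2).symm
  have : PL = T 2 + (4 : ℂ) • (T 1 : ℂ[T;T⁻¹]) := by
    rw [smul_eq_C_mul, ← h4]; rfl
  rw [this, map_add, Derivation.map_smul, ddt_T, ddt_T, smul_eq_C_mul, smul_eq_C_mul,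
    smul_eq_C_mul, ← h4]
  norm_num
  rw [← h2]
  ring

/-- The derivation `D = (t + 2) ∂/∂u + u ∂/∂t` of the three-point ring. -/
def D : Derivation ℂ ThreePointRing ThreePointRing :=
  Derivation.mk'
    { toFun := fun x => ⟨PL * ddt x.im + (T 1 + 2) * x.im, ddt x.re⟩
      map_add' := fun x y => by
        ext1
        · simp only [QuadraticAlgebra.im_add, QuadraticAlgebra.re_add, map_add]; ring
        · simp
      map_smul' := fun c x => by
        ext1
        · simp only [QuadraticAlgebra.im_smul, QuadraticAlgebra.re_smul, Derivation.map_smul,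
            mul_smul_comm, smul_add, RingHom.id_apply]
        · simp }
    fun x y => by
      have h := ddt_PL
      ext1
      · simp only [LinearMap.coe_mk, AddHom.coe_mk, QuadraticAlgebra.re_mul,
          QuadraticAlgebra.im_mul, smul_eq_mul, QuadraticAlgebra.re_add, map_add,
          Derivation.leibniz, zero_mul, add_zero]
        ring
      · simp only [LinearMap.coe_mk, AddHom.coe_mk, QuadraticAlgebra.re_mul,
          QuadraticAlgebra.im_mul, smul_eq_mul, QuadraticAlgebra.im_add, map_add,
          Derivation.leibniz, zero_mul, add_zero, h]
        ring

theorem D_apply (x : ThreePointRing) :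
    D x = ⟨PL * ddt x.im + (T 1 + 2) * x.im, ddt x.re⟩ := rfl

theorem D_u : D u = tPow 1 + 2 := by
  rw [D_apply]
  ext1 <;> simp [u, tPow, QuadraticAlgebra.re_ofNat, QuadraticAlgebra.im_ofNat]

theorem D_tPow (n : ℤ) : D (tPow n) = (n : ℂ) • (tPow (n - 1) * u) := by
  rw [D_apply]
  ext1 <;> simp [u, tPow, ddt_T]

theorem add_two_sq : (tPow 1 + 2) * (tPow 1 + 2) - u * u = 4 := by
  have : tPow 2 = tPow 1 * tPow 1 := by rw [tPow_mul]; rfl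
  rw [u_mul_u, this]; ring

theorem der_tPow_eq_zero {η : Derivation ℂ ThreePointRing ThreePointRing}
    (ht : η (tPow 1) = 0) (n : ℤ) : η (tPow n) = 0 := by
  induction n using Int.induction_on with
  | zero => rw [tPow_zero, Derivation.map_one_eq_zero]
  | succ k ih => rw [← tPow_mul, Derivation.leibniz, ih, ht, smul_zero, smul_zero, add_zero]
  | pred k ih =>
    have h := ih
    rw [show (-(k : ℤ)) = 1 + (-(k : ℤ) - 1) by ring, ← tPow_mul, Derivation.leibniz, ht,
      smul_zero, add_zero, smul_eq_mul] at h
    have h2 := congrArg (fun x => tPow (-1) * x) h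
    simpa only [← mul_assoc, tPow_mul, neg_add_cancel, tPow_zero, one_mul, mul_zero] using h2

theorem der_ext {δ ε : Derivation ℂ ThreePointRing ThreePointRing}
    (ht : δ (tPow 1) = ε (tPow 1)) (hu : δ u = ε u) : δ = ε := by
  have h0 : ∀ n, δ (tPow n) = ε (tPow n) := fun n => by
    have := der_tPow_eq_zero (η := δ - ε) (by simp [ht]) n
    simpa [sub_eq_zero] using this
  have hT : ∀ f : ℂ[T;T⁻¹], δ (algebraMap _ ThreePointRing f) = ε (algebraMap _ _ f) := by
    intro f
    have key : δ.toLinearMap ∘ₗ ((Algebra.linearMap ℂ[T;T⁻¹] ThreePointRing).restrictScalars ℂ) =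
        ε.toLinearMap ∘ₗ ((Algebra.linearMap ℂ[T;T⁻¹] ThreePointRing).restrictScalars ℂ) := by
      refine (AddMonoidAlgebra.basis ℤ ℂ).ext fun n => ?_
      rw [laurent_basis]
      exact h0 n
    exact congrArg (fun F => F f) key
  ext1 x
  have hx : x = algebraMap _ _ x.re + algebraMap _ _ x.im * u := by
    ext1 <;> simp [u]
  rw [hx, map_add, map_add, Derivation.leibniz, Derivation.leibniz, hT, hT, hu]

/-- The coefficient `r` of a derivation `r D` of the three-point ring. -/
def derCoeff (δ : Derivation ℂ ThreePointRing ThreePointRing) : ThreePointRing :=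
  (1 / 4 : ℂ) • ((tPow 1 + 2) * δ u - u * δ (tPow 1))

theorem D_t : D (tPow 1) = u := by
  rw [D_tPow]; simp [tPow_zero]

theorem quarter_mul_four (x : ThreePointRing) : (1 / 4 : ℂ) • (4 * x) = x := by
  rw [show (4 : ThreePointRing) * x = (4 : ℂ) • x by
    rw [Algebra.smul_def, map_ofNat]]
  rw [smul_smul]; norm_num

theorem derCoeff_smul_D (r : ThreePointRing) : derCoeff (r • D) = r := by
  rw [derCoeff, Derivation.smul_apply, Derivation.smul_apply, D_u, D_t]
  simp only [smul_eq_mul]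
  rw [show (tPow 1 + 2) * (r * (tPow 1 + 2)) - u * (r * u) =
    ((tPow 1 + 2) * (tPow 1 + 2) - u * u) * r by ring, add_two_sq, quarter_mul_four]

/-- Every derivation of the three-point ring is a multiple of `D`. -/
theorem derCoeff_smul_self (δ : Derivation ℂ ThreePointRing ThreePointRing) :
    derCoeff δ • D = δ := by
  have h : u * δ u = (tPow 1 + 2) * δ (tPow 1) := by
    have h1 := congrArg δ u_mul_u
    have h2 : tPow 2 = tPow 1 * tPow 1 := by rw [tPow_mul]; rfl
    have h4 : δ 4 = 0 := by exact_mod_cast δ.map_natCast 4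
    rw [h2, map_add, Derivation.leibniz, Derivation.leibniz, Derivation.leibniz, h4] at h1
    simp only [smul_eq_mul, mul_zero, add_zero] at h1
    have h3 := congrArg (fun x => (1 / 4 : ℂ) • (2 * x)) h1
    rw [← quarter_mul_four (u * δ u), ← quarter_mul_four ((tPow 1 + 2) * δ (tPow 1))]
    convert h3 using 2 <;> ring
  refine der_ext ?_ ?_
  · rw [Derivation.smul_apply, D_t, derCoeff, smul_eq_mul, smul_mul_assoc,
      show ((tPow 1 + 2) * δ u - u * δ (tPow 1)) * u = 4 * δ (tPow 1) by
        rw [← add_two_sq]; linear_combination (tPow 1 + 2) * h, quarter_mul_four]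
  · rw [Derivation.smul_apply, D_u, derCoeff, smul_eq_mul, smul_mul_assoc,
      show ((tPow 1 + 2) * δ u - u * δ (tPow 1)) * (tPow 1 + 2) = 4 * δ u by
        rw [← add_two_sq]; linear_combination u * h, quarter_mul_four]

/-- The 3-point Witt algebra: the derivations of the three-point ring, with the commutator. -/
abbrev Witt : Type := Derivation ℂ ThreePointRing ThreePointRing

/-- The vector fields `d_n = tⁿ u D`. -/
def d (n : ℤ) : Witt := (tPow n * u) • D

/-- The vector fields `d¹_n = tⁿ D`. -/
def d1 (n : ℤ) : Witt := tPow n • D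

/-- Coordinates on the Witt algebra: `(g, f)` stands for `(f + g u) D`. -/
def wittEquiv : (ℂ[T;T⁻¹] × ℂ[T;T⁻¹]) ≃ₗ[ℂ] Witt where
  toFun x := (⟨x.2, x.1⟩ : ThreePointRing) • D
  invFun δ := ((derCoeff δ).im, (derCoeff δ).re)
  map_add' x y := by rw [← add_smul]; rfl
  map_smul' c x := by rw [RingHom.id_apply, ← smul_assoc]; rfl
  left_inv x := by simp only [derCoeff_smul_D]
  right_inv δ := derCoeff_smul_self δ

/-- The basis `d_n`, `d¹_n` (`n ∈ ℤ`) of the Witt algebra. -/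
def wittBasis : Module.Basis (ℤ ⊕ ℤ) ℂ Witt :=
  ((AddMonoidAlgebra.basis ℤ ℂ).prod (AddMonoidAlgebra.basis ℤ ℂ)).map wittEquiv

theorem wittBasis_inl (n : ℤ) : wittBasis (Sum.inl n) = d n := by
  rw [wittBasis, Module.Basis.map_apply, Module.Basis.prod_apply]
  simp only [Sum.elim_inl, Function.comp_apply, LinearMap.inl_apply, laurent_basis]
  change (_ : ThreePointRing) • D = (_ : ThreePointRing) • D
  congr 1
  ext1 <;> simp [tPow, u]

theorem wittBasis_inr (n : ℤ) : wittBasis (Sum.inr n) = d1 n := by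
  rw [wittBasis, Module.Basis.map_apply, Module.Basis.prod_apply]
  simp only [Sum.elim_inr, Function.comp_apply, LinearMap.inr_apply, laurent_basis]
  rfl

theorem lie_smul_D (r s : ThreePointRing) : ⁅r • D, s • D⁆ = (r * D s - s * D r) • D := by
  ext1 x
  simp only [Derivation.commutator_apply, Derivation.smul_apply, smul_eq_mul, Derivation.leibniz]
  ring

theorem D_tPow_mul_u (n : ℤ) : D (tPow n * u) =
    tPow n * (tPow 1 + 2) + n * tPow n * tPow (-1) * (tPow 2 + 4 * tPow 1) := by
  rw [Derivation.leibniz, D_u, D_tPow, ← u_mul_u, sub_eq_add_neg, ← tPow_mul, smul_eq_mul,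
    smul_eq_mul, Algebra.smul_def, map_intCast]
  ring

theorem D_tPow' (n : ℤ) : D (tPow n) = n * tPow n * tPow (-1) * u := by
  rw [D_tPow, sub_eq_add_neg, ← tPow_mul, Algebra.smul_def, map_intCast]
  ring

theorem tPow_one_mul_neg : tPow 1 * tPow (-1) = 1 := by
  rw [tPow_mul, add_neg_cancel, tPow_zero]

theorem tPow_two : tPow 2 = tPow 1 * tPow 1 := by rw [tPow_mul]; rfl

theorem lie_d_d (m n : ℤ) :
    ⁅d m, d n⁆ = ((n : ℂ) - m) • (d (m + n + 1) + (4 : ℂ) • d (m + n)) := by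
  simp only [d]
  rw [lie_smul_D, ← smul_assoc, ← add_smul, ← smul_assoc]
  congr 1
  rw [D_tPow_mul_u, D_tPow_mul_u, Algebra.smul_def, Algebra.smul_def, map_sub, map_intCast,
    map_intCast, map_ofNat, ← tPow_mul, ← tPow_mul, tPow_two]
  linear_combination ((n : ThreePointRing) - m) * tPow m * tPow n * u * (tPow 1 + 4) *
    tPow_one_mul_neg

theorem lie_d1_d1 (m n : ℤ) : ⁅d1 m, d1 n⁆ = ((n : ℂ) - m) • d (m + n - 1) := by
  simp only [d, d1]
  rw [lie_smul_D, ← smul_assoc]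
  congr 1
  rw [D_tPow', D_tPow', Algebra.smul_def, map_sub, map_intCast, map_intCast, sub_eq_add_neg
    (m + n), ← tPow_mul, ← tPow_mul]
  ring

theorem lie_d_d1 (m n : ℤ) : ⁅d m, d1 n⁆ =
    ((n : ℂ) - m - 1) • d1 (m + n + 1) + (4 * (n : ℂ) - 4 * m - 2) • d1 (m + n) := by
  simp only [d, d1]
  rw [lie_smul_D, ← smul_assoc, ← smul_assoc, ← add_smul]
  congr 1
  rw [D_tPow', D_tPow_mul_u, Algebra.smul_def, Algebra.smul_def, map_sub, map_sub, map_sub,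
    map_sub, map_mul, map_mul, map_intCast, map_intCast, map_ofNat, map_ofNat, map_one,
    ← tPow_mul, ← tPow_mul, tPow_two]
  have hu := u_mul_u
  rw [tPow_two] at hu
  linear_combination (n : ThreePointRing) * tPow m * tPow n * tPow (-1) * hu +
    ((n : ThreePointRing) - m) * tPow m * tPow n * (tPow 1 + 4) * tPow_one_mul_neg

theorem lie_d1_d (m n : ℤ) : ⁅d1 n, d m⁆ =
    -(((n : ℂ) - m - 1) • d1 (m + n + 1) + (4 * (n : ℂ) - 4 * m - 2) • d1 (m + n)) := by
  rw [← lie_d_d1, lie_skew]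

/-- The double factorial `(2N - 3)!!` for `N ≥ -1`, continued to negative odd numbers by
`(j + 2)!! = (j + 2) j!!`, so that `(-1)!! = 1`, `(-3)!! = -1` and `(-5)!! = 1/3`. -/
def oddDoubleFactorial (N : ℤ) : ℂ :=
  if N = -1 then 1 / 3 else if N = 0 then -1 else (Nat.doubleFactorial (2 * N - 3).toNat : ℂ)

/-- The number `6 (-1)^N 2^N (2N - 3)!! / (N + 1)!`, where `1 / (N + 1)! = 0` for `N < -1`. -/
def mixedCoeff (N : ℤ) : ℂ :=
  if N < -1 then 0 else
    6 * (-1) ^ N * 2 ^ N * oddDoubleFactorial N / (Nat.factorial (N + 1).toNat : ℂ)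

theorem mixedCoeff_rec (N : ℤ) :
    ((N : ℂ) + 2) * mixedCoeff (N + 1) + (4 * N - 2) * mixedCoeff N = 0 := by
  rcases lt_trichotomy N (-2) with h | rfl | h
  · simp [mixedCoeff, show N < -1 by omega, show N + 1 < -1 by omega]
  · simp [mixedCoeff]
  · rcases lt_trichotomy N 0 with h0 | rfl | h0
    · obtain rfl : N = -1 := by omega
      norm_num [mixedCoeff, oddDoubleFactorial]
    · norm_num [mixedCoeff, oddDoubleFactorial, show (2 : ℤ).toNat = 2 from rfl,
        show (-1 : ℤ).toNat = 0 from rfl, Nat.factorial]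
    · obtain ⟨k, rfl⟩ : ∃ k : ℕ, N = k + 1 := ⟨(N - 1).toNat, by omega⟩
      have e1 : (2 * ((k : ℤ) + 1 + 1) - 3).toNat = 2 * k + 1 := by omega
      have e2 : Nat.doubleFactorial (2 * k + 1) =
          (2 * k + 1) * Nat.doubleFactorial (2 * ((k : ℤ) + 1) - 3).toNat := by
        cases k with
        | zero => rfl
        | succ j =>
          rw [show (2 * (((j + 1 : ℕ) : ℤ) + 1) - 3).toNat = 2 * j + 1 by omega]
          rfl
      have e3 : ((k : ℤ) + 1 + 1 + 1).toNat = k + 2 + 1 := by omega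
      have e4 : ((k : ℤ) + 1 + 1).toNat = k + 2 := by omega
      simp only [mixedCoeff, oddDoubleFactorial, show ¬ ((k : ℤ) + 1 + 1 < -1) by omega,
        show ¬ ((k : ℤ) + 1 < -1) by omega, show ¬ ((k : ℤ) + 1 + 1 = -1) by omega,
        show ¬ ((k : ℤ) + 1 = -1) by omega, show ¬ ((k : ℤ) + 1 + 1 = 0) by omega,
        show ¬ ((k : ℤ) + 1 = 0) by omega, if_false, e1, e2, e3, e4, Nat.factorial_succ (k + 2),
        zpow_add₀ (show (2 : ℂ) ≠ 0 by norm_num), zpow_add₀ (show (-1 : ℂ) ≠ 0 by norm_num)]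
      have : (Nat.factorial (k + 2) : ℂ) ≠ 0 := by exact_mod_cast Nat.factorial_ne_zero _
      have : (k : ℂ) + 2 + 1 ≠ 0 := by exact_mod_cast Nat.succ_ne_zero (k + 2)
      push_cast
      field_simp
      ring

/-- The values of `φ₁` on the basis: `Sum.inl n` stands for `d_n` and `Sum.inr n` for `d¹_n`. -/
def phi₁Basis : ℤ ⊕ ℤ → ℤ ⊕ ℤ → ℂ
  | .inr k, .inr l =>
      2 * ((l : ℂ) ^ 2 - l) * (2 * l - 1) * (if k + l = 1 then 1 else 0)
        + ((l : ℂ) ^ 3 - l) * (if k + l = 0 then 1 else 0)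
  | .inr k, .inl l => ((k : ℂ) - 1) * k * l * mixedCoeff (k + l)
  | .inl l, .inr k => -(((k : ℂ) - 1) * k * l * mixedCoeff (k + l))
  | .inl k, .inl l =>
      (l : ℂ) * (l + 1) * (l + 2) * (if k + l = -2 then 1 else 0)
        + 4 * l * (2 * l + 1) * (l + 1) * (if k + l = -1 then 1 else 0)
        + 4 * l * (2 * l - 1) * (2 * l + 1) * (if k + l = 0 then 1 else 0)

/-- The values of `φ₂` on the basis. -/
def phi₂Basis : ℤ ⊕ ℤ → ℤ ⊕ ℤ → ℂ
  | .inr k, .inr l => -2 * phi₁Basis (.inr k) (.inr l)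
  | .inl k, .inl l => -2 * phi₁Basis (.inl k) (.inl l)
  | .inr _, .inl _ => 0
  | .inl _, .inr _ => 0

theorem phi₁Basis_skew (i j : ℤ ⊕ ℤ) : phi₁Basis i j = -phi₁Basis j i := by
  rcases i with k | k <;> rcases j with l | l <;> simp only [phi₁Basis, neg_neg, add_comm l k]
  · by_cases h : k + l = -2
    · obtain rfl : k = -2 - l := by omega
      simp; ring
    by_cases h : k + l = -1
    · obtain rfl : k = -1 - l := by omega
      simp; ring
    by_cases h : k + l = 0
    · obtain rfl : k = -l := by omega
      simp; ring
    simp [*]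
  · by_cases h : k + l = 1
    · obtain rfl : k = 1 - l := by omega
      simp; ring
    by_cases h : k + l = 0
    · obtain rfl : k = -l := by omega
      simp; ring
    simp [*]

theorem phi₂Basis_skew (i j : ℤ ⊕ ℤ) : phi₂Basis i j = -phi₂Basis j i := by
  rcases i with k | k <;> rcases j with l | l <;> simp only [phi₂Basis, neg_zero]
  · rw [phi₁Basis_skew]; ring
  · rw [phi₁Basis_skew]; ring

/-- The centre `ℂ c₁ ⊕ ℂ c₂`, with the trivial action of the Witt algebra. -/
abbrev Centre : Type := TrivialLieModule ℂ Witt (ℂ × ℂ)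

/-- The bilinear extension `φ₁ c₁ + φ₂ c₂`. -/
def cocycleBilin : Witt →ₗ[ℂ] Witt →ₗ[ℂ] Centre :=
  wittBasis.constr ℂ fun i => wittBasis.constr ℂ fun j =>
    (TrivialLieModule.equiv ℂ Witt (ℂ × ℂ)).symm (phi₁Basis i j, phi₂Basis i j)

theorem cocycleBilin_basis (i j : ℤ ⊕ ℤ) : cocycleBilin (wittBasis i) (wittBasis j) =
    (TrivialLieModule.equiv ℂ Witt (ℂ × ℂ)).symm (phi₁Basis i j, phi₂Basis i j) := by
  rw [cocycleBilin, Module.Basis.constr_basis, Module.Basis.constr_basis]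

theorem cocycleBilin_self (x : Witt) : cocycleBilin x x = 0 := by
  have key : cocycleBilin = -cocycleBilin.flip := by
    refine wittBasis.ext fun i => wittBasis.ext fun j => ?_
    rw [LinearMap.neg_apply, LinearMap.neg_apply, LinearMap.flip_apply, cocycleBilin_basis,
      cocycleBilin_basis, phi₁Basis_skew, phi₂Basis_skew, ← map_neg]
    rfl
  have h : cocycleBilin x x = -cocycleBilin x x := by
    conv_lhs => rw [key]
    rfl
  have h2 : (2 : ℂ) • cocycleBilin x x = 0 := by
    rw [two_smul]; nth_rewrite 1 [h]; exact neg_add_cancel _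
  exact (smul_eq_zero.mp h2).resolve_left two_ne_zero

open LieModule.Cohomology

/-- The bilinear map as an alternating 2-cochain. -/
def cochain : twoCochain ℂ Witt Centre := ⟨cocycleBilin, cocycleBilin_self⟩

theorem cochain_d_d (m n : ℤ) : cochain (d m) (d n) = (TrivialLieModule.equiv ℂ Witt (ℂ × ℂ)).symm
    (phi₁Basis (.inl m) (.inl n), phi₂Basis (.inl m) (.inl n)) := by
  rw [← wittBasis_inl, ← wittBasis_inl]; exact cocycleBilin_basis _ _

theorem cochain_d_d1 (m n : ℤ) : cochain (d m) (d1 n) =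
    (TrivialLieModule.equiv ℂ Witt (ℂ × ℂ)).symm
    (phi₁Basis (.inl m) (.inr n), phi₂Basis (.inl m) (.inr n)) := by
  rw [← wittBasis_inl, ← wittBasis_inr]; exact cocycleBilin_basis _ _

theorem cochain_d1_d (m n : ℤ) : cochain (d1 m) (d n) =
    (TrivialLieModule.equiv ℂ Witt (ℂ × ℂ)).symm
    (phi₁Basis (.inr m) (.inl n), phi₂Basis (.inr m) (.inl n)) := by
  rw [← wittBasis_inl, ← wittBasis_inr]; exact cocycleBilin_basis _ _

theorem cochain_d1_d1 (m n : ℤ) : cochain (d1 m) (d1 n) =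
    (TrivialLieModule.equiv ℂ Witt (ℂ × ℂ)).symm
    (phi₁Basis (.inr m) (.inr n), phi₂Basis (.inr m) (.inr n)) := by
  rw [← wittBasis_inr, ← wittBasis_inr]; exact cocycleBilin_basis _ _

theorem cochain_smul_left (a : ℂ) (x y : Witt) : cochain (a • x) y = a • cochain x y :=
  LinearMap.map_smul₂ cocycleBilin a x y

theorem cochain_add_left (x x' y : Witt) : cochain (x + x') y = cochain x y + cochain x' y :=
  LinearMap.map_add₂ cocycleBilin x x' y

theorem cochain_neg_left (x y : Witt) : cochain (-x) y = -cochain x y :=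
  LinearMap.map_neg₂ cocycleBilin x y

set_option maxHeartbeats 4000000 in
theorem cochain_mem : cochain ∈ twoCocycle ℂ Witt Centre := by
  rw [mem_twoCocycle_iff]
  refine wittBasis.ext fun i => wittBasis.ext fun j => wittBasis.ext fun l => ?_
  rw [d₂₃_apply]
  simp only [trivial_lie_zero, sub_self, add_zero, zero_sub, LinearMap.zero_apply]
  rcases i with m | m <;> rcases j with n | n <;> rcases l with k | k <;>
    obtain ⟨s, rfl⟩ : ∃ s, k = s - m - n := ⟨m + n + k, by ring⟩ <;>
    simp only [wittBasis_inl, wittBasis_inr, lie_d_d, lie_d1_d1, lie_d_d1, lie_d1_d,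
      cochain_smul_left, cochain_add_left, cochain_neg_left, cochain_d_d, cochain_d_d1,
      cochain_d1_d, cochain_d1_d1, ← map_smul, ← map_add, ← map_neg, ← map_sub,
      Prod.smul_mk, Prod.mk_add_mk, Prod.neg_mk, Prod.mk_sub_mk] <;>
    rw [← map_zero (TrivialLieModule.equiv ℂ Witt (ℂ × ℂ)).symm] <;>
    congr 1 <;>
    refine Prod.ext ?_ ?_ <;>
    simp only [phi₂Basis, phi₁Basis, Prod.fst_zero, Prod.snd_zero, smul_eq_mul]
  all_goals first
    | ring1
    | (by_cases h3 : s = -3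
       · subst h3
         simp (disch := omega) only [if_pos, if_neg]
         push_cast
         ring
       by_cases h2 : s = -2
       · subst h2
         simp (disch := omega) only [if_pos, if_neg]
         push_cast
         ring
       by_cases h1 : s = -1
       · subst h1
         simp (disch := omega) only [if_pos, if_neg]
         push_cast
         ring
       by_cases h0 : s = 0
       · subst h0
         simp (disch := omega) only [if_pos, if_neg]
         push_cast
         ring
       by_cases h4 : s = 1
       · subst h4
         simp (disch := omega) only [if_pos, if_neg]
         push_cast
         ring
       simp (disch := omega) only [if_neg]
       ring)
    | (push_cast; ring_nf; done)
    | (have hrec := mixedCoeff_rec s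
       push_cast
       ring_nf at hrec ⊢
       first
         | linear_combination ((n : ℂ) - m) * (((s : ℂ) - m - n) ^ 2 - (s - m - n) + m * n) * hrec
         | linear_combination -((n : ℂ) - m) * (((s : ℂ) - m - n) ^ 2 - (s - m - n) + m * n) * hrec
         | linear_combination ((s : ℂ) - m - n - m) * ((n : ℂ) ^ 2 - n + m * (s - m - n)) * hrec
         | linear_combination -((s : ℂ) - m - n - m) * ((n : ℂ) ^ 2 - n + m * (s - m - n)) * hrec
         | linear_combination ((s : ℂ) - m - n - n) * ((m : ℂ) ^ 2 - m + n * (s - m - n)) * hrec)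

/-- The 3-point Virasoro algebra: the central extension `𝔚 ⊕ ℂ c₁ ⊕ ℂ c₂` of the 3-point Witt
algebra `𝔚`, with bracket `[x + z, y + z'] = [x, y] + φ₁(x, y) c₁ + φ₂(x, y) c₂`. -/
abbrev Virasoro : Type :=
  LieAlgebra.ofTwoCocycle (⟨cochain, cochain_mem⟩ : twoCocycle ℂ Witt Centre)

/-- The element of the 3-point Virasoro algebra with the given components. -/
def Virasoro.of (x : Witt) (a₁ a₂ : ℂ) : Virasoro :=
  LieAlgebra.ofProd _ (x, (TrivialLieModule.equiv ℂ Witt (ℂ × ℂ)).symm (a₁, a₂))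

/-- The central element `c₁`. -/
def c₁ : Virasoro := Virasoro.of 0 1 0

/-- The central element `c₂`. -/
def c₂ : Virasoro := Virasoro.of 0 0 1

/-- The central element `c̄ = c₁ - 2 c₂`. -/
def cBar : Virasoro := c₁ - (2 : ℂ) • c₂

/-- `d̄_m = - d_{m+1}`, the coefficient of `z ^ (-m-2)` in `d̄(z)`. -/
def dBar (m : ℤ) : Virasoro := -Virasoro.of (d (m + 1)) 0 0

/-- `d̄¹_m = - d¹_{m+1}`, the coefficient of `z ^ (-m-2)` in `d̄¹(z)`. -/
def d1Bar (m : ℤ) : Virasoro := -Virasoro.of (d1 (m + 1)) 0 0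

/-! ### The Fock space -/

open scoped TensorProduct

/-- `ℂ[𝐱]`: the variable `(0, n)` is `x_n` and `(1, n)` is `x¹_n`. -/
abbrev Cx : Type := MvPolynomial (Fin 2 × ℤ) ℂ

/-- `ℂ[𝐲]`: the variable `(0, n)` is `y_n` and `(1, n)` is `y¹_n`, for `n < 0`. -/
abbrev Cy : Type := MvPolynomial (Fin 2 × {n : ℤ // n < 0}) ℂ

/-- The Fock space `ℂ[𝐱] ⊗ ℂ[𝐲] ⊗ 𝒱`, where `𝒱 = ℂ²` has the basis `v₀, v₁`. -/
abbrev Fock : Type := Cx ⊗[ℂ] (Cy ⊗[ℂ] (Fin 2 → ℂ))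

/-- Multiplication by a variable. -/
def mulVar {σ : Type} (i : σ) : Module.End ℂ (MvPolynomial σ ℂ) :=
  LinearMap.mulLeft ℂ (MvPolynomial.X i)

/-- The partial derivative with respect to a variable. -/
def derVar {σ : Type} (i : σ) : Module.End ℂ (MvPolynomial σ ℂ) :=
  (MvPolynomial.pderiv i).toLinearMap

/-- An operator on `ℂ[𝐱]`, acting on the first factor of the Fock space. -/
def onX (A : Module.End ℂ Cx) : Module.End ℂ Fock := A.rTensor _

/-- An operator on `ℂ[𝐲]`, acting on the second factor of the Fock space. -/
def onY (A : Module.End ℂ Cy) : Module.End ℂ Fock := (A.rTensor _).lTensor _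

/-- An operator on `𝒱`, acting on the third factor of the Fock space. -/
def onV (A : Module.End ℂ (Fin 2 → ℂ)) : Module.End ℂ Fock := (A.lTensor _).lTensor _

/-- The action of `a_m` (for `i = 0`) and of `a¹_m` (for `i = 1`). -/
def aMode (r i : Fin 2) (m : ℤ) : Module.End ℂ Fock :=
  onX (if 0 ≤ m ∧ r = 0 then derVar (i, m) else mulVar (i, m))

/-- The action of `a*_m` (for `i = 0`) and of `a¹*_m` (for `i = 1`). -/
def aStarMode (r i : Fin 2) (m : ℤ) : Module.End ℂ Fock :=
  onX (if m ≤ 0 ∧ r = 0 then mulVar (i, -m) else -derVar (i, -m))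

/-- The action of `b_n`. -/
def bMode (κ₀ B₀ : ℂ) (n : ℤ) : Module.End ℂ Fock :=
  if hn : n < 0 then onY (mulVar (0, ⟨n, hn⟩))
  else if hp : 0 < n then (-2 * n * κ₀) • onY (derVar (0, ⟨-n, by omega⟩))
  else B₀ • 1

/-- The action of `b¹_n`. On `𝒱`, `b¹_0` acts by `v_i ↦ B₁ i 0 • v₀ + B₁ i 1 • v₁`. -/
def b1Mode (κ₀ : ℂ) (B₁ : Matrix (Fin 2) (Fin 2) ℂ) (n : ℤ) : Module.End ℂ Fock :=
  if hn : n < 0 then onY (mulVar (1, ⟨n, hn⟩))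
  else (-(2 + 2 * n) * κ₀) • onY (derVar (1, ⟨-2 - n, by omega⟩))
    + (-4 * (1 + 2 * n) * κ₀) • onY (derVar (1, ⟨-1 - n, by omega⟩))
    + if n = 0 then onV B₁.vecMulLinear else 0

/-! ### Formal distributions -/

/-- A formal distribution `∑ A n * z ^ n` with coefficients in the operators on the Fock space. -/
abbrev Dist : Type := ℤ → Module.End ℂ Fock

/-- The derivative of a formal distribution. -/
def Dist.deriv (A : Dist) : Dist := fun n => ((n : ℂ) + 1) • A (n + 1)

/-- The product of a polynomial in `z` and a formal distribution. -/
def Dist.polyMul (p : Polynomial ℂ) (A : Dist) : Dist := fun n => p.sum fun k c => c • A (n - k)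

open Classical in
/-- The summands of the coefficient of `z ^ n` in `:A(z) B(z): = A(z)_+ B(z) + B(z) A(z)_-`, where
`A(z)_-` consists of the terms of `A(z)` whose exponent lies in `minus`. -/
def Dist.normalTerm (minus : Set ℤ) (A B : Dist) (n k : ℤ) : Module.End ℂ Fock :=
  if k ∈ minus then B (n - k) * A k else A k * B (n - k)

/-- The normal ordered product is well defined: applied to any vector, only finitely many of the
summands of each of its coefficients do not vanish. -/
def Dist.NormalSummable (minus : Set ℤ) (A B : Dist) : Prop :=
  ∀ (n : ℤ) (v : Fock), (Function.support fun k => Dist.normalTerm minus A B n k v).Finite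

open Classical in
/-- The normal ordered product `:A(z) B(z):` (and zero if it is not defined). -/
def Dist.normalProd (minus : Set ℤ) (A B : Dist) : Dist := fun n =>
  if h : Dist.NormalSummable minus A B then
    { toFun := fun v => ∑ᶠ k, Dist.normalTerm minus A B n k v
      map_add' := fun v w => by
        simp only [map_add]
        exact finsum_add_distrib (h n v) (h n w)
      map_smul' := fun c v => by
        simp only [map_smul, RingHom.id_apply]
        exact (smul_finsum' c (h n v)).symm }
  else 0

/-- `α(z)` and `α¹(z)`, with modes `a_n z ^ (-n-1)`. -/
def alpha (r i : Fin 2) : Dist := fun k => aMode r i (-k - 1)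

/-- `α*(z)` and `α¹*(z)`, with modes `a*_n z ^ (-n)`. -/
def alphaStar (r i : Fin 2) : Dist := fun k => aStarMode r i (-k)

/-- `β(z)`. -/
def beta (κ₀ B₀ : ℂ) : Dist := fun k => bMode κ₀ B₀ (-k - 1)

/-- `β¹(z)`. -/
def beta1 (κ₀ : ℂ) (B₁ : Matrix (Fin 2) (Fin 2) ℂ) : Dist := fun k => b1Mode κ₀ B₁ (-k - 1)

/-- The usual normal ordering: `A(z)_-` has the negative exponents. -/
def usual : Set ℤ := {k | k < 0}

/-- The exponents of `α(z)_-` and of `α¹(z)_-`: the usual ones for `r = 0` and none for `r = 1`. -/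
def alphaMinus (r : Fin 2) : Set ℤ := if r = 0 then usual else ∅

/-- `π(d)(z)`. -/
def piD (r : Fin 2) : Dist :=
  Dist.polyMul P (Dist.normalProd (alphaMinus r) (alpha r 0) (alphaStar r 0).deriv
      + Dist.normalProd (alphaMinus r) (alpha r 1) (alphaStar r 1).deriv)
    + Dist.polyMul (Polynomial.C (1 / 2) * Polynomial.derivative P)
      (Dist.normalProd (alphaMinus r) (alpha r 1) (alphaStar r 1))

/-- `π(d¹)(z)`. -/
def piD1 (r : Fin 2) : Dist :=
  Dist.normalProd (alphaMinus r) (alpha r 1) (alphaStar r 0).deriv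
    + Dist.polyMul P (Dist.normalProd (alphaMinus r) (alpha r 0) (alphaStar r 1).deriv)
    + Dist.polyMul (Polynomial.C (1 / 2) * Polynomial.derivative P)
      (Dist.normalProd (alphaMinus r) (alpha r 0) (alphaStar r 1))

/-- `π(d)(z) + γ :β(z)²: + μ ∂β(z) + γ₁ :β¹(z)²: + γ₂ β(z)`. -/
def fieldD (r : Fin 2) (κ₀ B₀ : ℂ) (B₁ : Matrix (Fin 2) (Fin 2) ℂ)
    (γ μ γ₁ γ₂ : Polynomial ℂ) : Dist :=
  piD r + Dist.polyMul γ (Dist.normalProd usual (beta κ₀ B₀) (beta κ₀ B₀))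
    + Dist.polyMul μ (beta κ₀ B₀).deriv
    + Dist.polyMul γ₁ (Dist.normalProd usual (beta1 κ₀ B₁) (beta1 κ₀ B₁))
    + Dist.polyMul γ₂ (beta κ₀ B₀)

/-- `π(d¹)(z) + ν :β(z) β¹(z): + ζ ∂β¹(z)`. -/
def fieldD1 (r : Fin 2) (κ₀ B₀ : ℂ) (B₁ : Matrix (Fin 2) (Fin 2) ℂ)
    (ν ζ : Polynomial ℂ) : Dist :=
  piD1 r + Dist.polyMul ν (Dist.normalProd usual (beta κ₀ B₀) (beta1 κ₀ B₁))
    + Dist.polyMul ζ (beta1 κ₀ B₁).deriv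

end
end ThreePoint

attribute [local instance 100] LieRing.ofAssociativeRing

/-!
The coefficients of the fields are infinite sums of normal ordered products of two modes, and the
brackets of the modes themselves are scalars. Everything is deduced from these scalars, for
operators on an arbitrary complex vector space; the Fock space enters only at the end.

Consider the weighted products `∑ w k :A k * B (n - k):` (`wNormal`), where `A k` acts first for the
exponents `k` in a set `M`. Bracketing with an operator is a derivation of such products
(`lie_wNormal`). If the operator maps modes to shifted modes, the shift can be absorbed in the
summation index, but this shifts the set `M` as well (`wNormal_scale_shift_left`). Moving `M` back
reorders finitely many pairs of modes, and the result changes by the sum of their brackets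
(`wNormal_cut`). For `M = {k | k < c}` this sum is `F c - F 0`, where `F` is any solution of the
difference equation `F (k + 1) - F k = w k * ω k`. As all weights are polynomials, so is `F`, and no
case distinction on the signs of the indices is needed. For `r = 1` the set `M` of the fields `α`,
`α¹` is empty, nothing has to be moved, and their contribution to the central charge vanishes.

In this way the products `:α^i α^{j*}:` with affine weights have explicit brackets
(`IsBetaGamma.lie_linNormal`), which gives the relations of the 3-point Virasoro algebra with
`c̄ ↦ -δ_{r,0} / 3` for the `βγ` part of the formulas. For the Heisenberg part one computes the
brackets with `β` and `β¹` and applies the derivation rule again; here `c̄ ↦ -1 / 6`. In the bracket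
of `d̄¹` with itself the weight `k` of `:β²:` and of `:(β¹)²:` has to be replaced by its mean
`n / 2`, which is possible by the symmetry of these products (`IsHeisenberg.pow_one₀₀`,
`IsHeisenberg.pow_one₁₁`). The two parts commute, so that the central charges add up.

Since `c₁ ↦ 0`, the element `c₂` acts by `-C / 2` if `c̄` acts by `C`. Hence `φ₁ c₁ + φ₂ c₂` acts by
`C φ₁` on the pairs `(d, d)` and `(d¹, d¹)` and by zero on the mixed pairs. These are the scalars
found above, and the brackets of the basis vectors determine the representation
(`IsVirasoroPair.existsUnique_rep`).
-/

namespace ThreePoint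

noncomputable section

variable {V : Type*} [AddCommGroup V] [Module ℂ V]

/-! ### Weighted normal ordered products -/

/-- Local finiteness of the factors which act first, `A k` for `k ∈ M` and `B (n - k)` for `k ∉ M`.
It makes all products `∑ w k :A k * B (n - k):` well defined. Unlike `Dist.NormalSummable`, it is a
condition on the two factors separately, and hence stable under shifts and rescalings. -/
structure Admissible (M : Set ℤ) (A B : ℤ → Module.End ℂ V) : Prop where
  left : ∀ v, {k | k ∈ M ∧ A k v ≠ 0}.Finite
  right : ∀ v n, {k | k ∉ M ∧ B (n - k) v ≠ 0}.Finite

open Classical in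
/-- The summand `:A k * B (n - k):` of a normal ordered product, applied to a vector. The factor
`A k` acts first for `k ∈ M`. This is `Dist.normalTerm` on an arbitrary vector space. -/
def normalTerm (M : Set ℤ) (A B : ℤ → Module.End ℂ V) (n k : ℤ) (v : V) : V :=
  if k ∈ M then B (n - k) (A k v) else A k (B (n - k) v)

theorem normalTerm_add (M : Set ℤ) (A B : ℤ → Module.End ℂ V) (n k : ℤ) (v v' : V) :
    normalTerm M A B n k (v + v') = normalTerm M A B n k v + normalTerm M A B n k v' := by
  by_cases hk : k ∈ M <;> simp [normalTerm, hk]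

theorem normalTerm_smul (M : Set ℤ) (A B : ℤ → Module.End ℂ V) (n k : ℤ) (c : ℂ) (v : V) :
    normalTerm M A B n k (c • v) = c • normalTerm M A B n k v := by
  by_cases hk : k ∈ M <;> simp [normalTerm, hk]

theorem Admissible.finite_support {M : Set ℤ} {A B : ℤ → Module.End ℂ V} (h : Admissible M A B)
    (w : ℤ → ℂ) (n : ℤ) (v : V) :
    (Function.support fun k => w k • normalTerm M A B n k v).Finite := by
  refine ((h.left v).union (h.right v n)).subset fun k hk => ?_
  rw [Function.mem_support] at hk
  by_cases hM : k ∈ M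
  · refine Or.inl ⟨hM, fun h0 => hk ?_⟩
    simp [normalTerm, hM, h0]
  · refine Or.inr ⟨hM, fun h0 => hk ?_⟩
    simp [normalTerm, hM, h0]

theorem Admissible.scale_shift_left {M : Set ℤ} {A B : ℤ → Module.End ℂ V} {s : ℤ}
    (h : Admissible {k | k - s ∈ M} A B) (φ : ℤ → ℂ) :
    Admissible M (fun k => φ k • A (k + s)) B where
  left v := by
    refine ((h.left v).preimage (add_left_injective s).injOn).subset fun k hk =>
      ⟨?_, fun h0 => hk.2 ?_⟩
    · simpa using hk.1
    · simp [h0]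
  right v n := by
    refine ((h.right v (n + s)).preimage (add_left_injective s).injOn).subset fun k hk => ⟨?_, ?_⟩
    · simpa using hk.1
    · simpa [add_sub_add_right_eq_sub] using hk.2

theorem Admissible.scale_shift_right {M : Set ℤ} {A B : ℤ → Module.End ℂ V}
    (h : Admissible M A B) (φ : ℤ → ℂ) (s : ℤ) :
    Admissible M A (fun k => φ k • B (k + s)) where
  left := h.left
  right v n := by
    refine (h.right v (n + s)).subset fun k hk => ⟨hk.1, fun h0 => hk.2 ?_⟩
    simp [show n - k + s = n + s - k by ring, h0]

theorem Admissible.add_left {M : Set ℤ} {A A' B : ℤ → Module.End ℂ V} (h : Admissible M A B)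
    (h' : Admissible M A' B) : Admissible M (fun k => A k + A' k) B where
  left v := by
    refine ((h.left v).union (h'.left v)).subset fun k hk => ?_
    by_contra hc
    simp only [Set.mem_union, Set.mem_ofPred_eq, hk.1, true_and, not_or, not_not] at hc
    exact hk.2 (by simp [hc.1, hc.2])
  right := h.right

theorem Admissible.add_right {M : Set ℤ} {A B B' : ℤ → Module.End ℂ V} (h : Admissible M A B)
    (h' : Admissible M A B') : Admissible M A (fun k => B k + B' k) where
  left := h.left
  right v n := by
    refine ((h.right v n).union (h'.right v n)).subset fun k hk => ?_
    by_contra hc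
    simp only [Set.mem_union, Set.mem_ofPred_eq, hk.1, not_false_eq_true, true_and, not_or,
      not_not] at hc
    exact hk.2 (by simp [hc.1, hc.2])

theorem Admissible.zero_left {M : Set ℤ} {A B : ℤ → Module.End ℂ V} (h : Admissible M A B) :
    Admissible M 0 B := ⟨fun v => by simp, h.right⟩

theorem Admissible.zero_right {M : Set ℤ} {A B : ℤ → Module.End ℂ V} (h : Admissible M A B) :
    Admissible M A 0 := ⟨h.left, fun v n => by simp⟩

theorem Admissible.single_left {M : Set ℤ} {A B : ℤ → Module.End ℂ V} (h : Admissible M A B)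
    (a : ℂ) (p : ℤ) :
    Admissible M (fun k => (if k = p then a else 0) • (1 : Module.End ℂ V)) B where
  left v := (Set.finite_singleton p).subset fun k hk => by
    by_contra hc
    exact hk.2 (by simp [show k ≠ p from hc])
  right := h.right

theorem Admissible.single_right {M : Set ℤ} {A B : ℤ → Module.End ℂ V} (h : Admissible M A B)
    (a : ℂ) (p : ℤ) :
    Admissible M A (fun k => (if k = p then a else 0) • (1 : Module.End ℂ V)) where
  left := h.left
  right v n := (Set.finite_singleton (n - p)).subset fun k hk => by
    by_contra hc
    have hc : k ≠ n - p := hc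
    exact hk.2 (by simp [show n - k ≠ p by omega])

open Classical in
/-- The coefficient `∑ w k :A k * B (n - k):` of a weighted normal ordered product (and zero if it
is not defined). -/
def wNormal (M : Set ℤ) (w : ℤ → ℂ) (A B : ℤ → Module.End ℂ V) (n : ℤ) : Module.End ℂ V :=
  if h : Admissible M A B then
    { toFun := fun v => ∑ᶠ k, w k • normalTerm M A B n k v
      map_add' := fun v v' => by
        simp only [normalTerm_add, smul_add]
        exact finsum_add_distrib (h.finite_support w n v) (h.finite_support w n v')
      map_smul' := fun c v => by
        simp only [normalTerm_smul, RingHom.id_apply]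
        rw [smul_finsum' c (h.finite_support w n v)]
        exact finsum_congr fun k => smul_comm _ _ _ }
  else 0

theorem wNormal_apply {M : Set ℤ} {A B : ℤ → Module.End ℂ V} (h : Admissible M A B) (w : ℤ → ℂ)
    (n : ℤ) (v : V) : wNormal M w A B n v = ∑ᶠ k, w k • normalTerm M A B n k v := by
  rw [wNormal, dif_pos h]; rfl

theorem wNormal_add_weight {M : Set ℤ} {A B : ℤ → Module.End ℂ V} (h : Admissible M A B)
    (w w' : ℤ → ℂ) (n : ℤ) : wNormal M (fun k => w k + w' k) A B n = wNormal M w A B n + wNormal M w' A B n := by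
  refine LinearMap.ext fun v => ?_
  rw [LinearMap.add_apply, wNormal_apply h, wNormal_apply h, wNormal_apply h,
    ← finsum_add_distrib (h.finite_support w n v) (h.finite_support w' n v)]
  simp only [add_smul]

theorem wNormal_smul_weight {M : Set ℤ} {A B : ℤ → Module.End ℂ V} (h : Admissible M A B) (c : ℂ)
    (w : ℤ → ℂ) (n : ℤ) : wNormal M (fun k => c * w k) A B n = c • wNormal M w A B n := by
  refine LinearMap.ext fun v => ?_
  rw [LinearMap.smul_apply, wNormal_apply h, wNormal_apply h,
    smul_finsum' c (h.finite_support w n v)]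
  simp only [mul_smul]

theorem wNormal_add_left {M : Set ℤ} {A A' B : ℤ → Module.End ℂ V} (h : Admissible M A B)
    (h' : Admissible M A' B) (w : ℤ → ℂ) (n : ℤ) :
    wNormal M w (fun k => A k + A' k) B n = wNormal M w A B n + wNormal M w A' B n := by
  refine LinearMap.ext fun v => ?_
  rw [LinearMap.add_apply, wNormal_apply (h.add_left h'), wNormal_apply h, wNormal_apply h',
    ← finsum_add_distrib (h.finite_support w n v) (h'.finite_support w n v)]
  refine finsum_congr fun k => ?_
  by_cases hk : k ∈ M <;> simp [normalTerm, hk]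

theorem wNormal_add_right {M : Set ℤ} {A B B' : ℤ → Module.End ℂ V} (h : Admissible M A B)
    (h' : Admissible M A B') (w : ℤ → ℂ) (n : ℤ) :
    wNormal M w A (fun k => B k + B' k) n = wNormal M w A B n + wNormal M w A B' n := by
  refine LinearMap.ext fun v => ?_
  rw [LinearMap.add_apply, wNormal_apply (h.add_right h'), wNormal_apply h, wNormal_apply h',
    ← finsum_add_distrib (h.finite_support w n v) (h'.finite_support w n v)]
  refine finsum_congr fun k => ?_
  by_cases hk : k ∈ M <;> simp [normalTerm, hk]

theorem wNormal_zero_left {M : Set ℤ} {A B : ℤ → Module.End ℂ V} (h : Admissible M A B) (w : ℤ → ℂ)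
    (n : ℤ) : wNormal M w 0 B n = 0 := by
  refine LinearMap.ext fun v => ?_
  rw [wNormal_apply h.zero_left]
  simp [normalTerm]

theorem wNormal_zero_right {M : Set ℤ} {A B : ℤ → Module.End ℂ V} (h : Admissible M A B) (w : ℤ → ℂ)
    (n : ℤ) : wNormal M w A 0 n = 0 := by
  refine LinearMap.ext fun v => ?_
  rw [wNormal_apply h.zero_right]
  simp [normalTerm]

theorem wNormal_single_left {M : Set ℤ} {A B : ℤ → Module.End ℂ V} (h : Admissible M A B)
    (w : ℤ → ℂ) (n : ℤ) (a : ℂ) (p : ℤ) :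
    wNormal M w (fun k => (if k = p then a else 0) • (1 : Module.End ℂ V)) B n =
      (w p * a) • B (n - p) := by
  refine LinearMap.ext fun v => ?_
  rw [wNormal_apply (h.single_left a p), finsum_eq_single _ p]
  · by_cases hk : p ∈ M <;> simp [normalTerm, hk, mul_smul]
  · intro k hk
    by_cases hM : k ∈ M <;> simp [normalTerm, hM, hk]

theorem wNormal_single_right {M : Set ℤ} {A B : ℤ → Module.End ℂ V} (h : Admissible M A B)
    (w : ℤ → ℂ) (n : ℤ) (a : ℂ) (p : ℤ) :
    wNormal M w A (fun k => (if k = p then a else 0) • (1 : Module.End ℂ V)) n =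
      (w (n - p) * a) • A (n - p) := by
  refine LinearMap.ext fun v => ?_
  rw [wNormal_apply (h.single_right a p), finsum_eq_single _ (n - p)]
  · by_cases hk : n - p ∈ M <;> simp [normalTerm, hk, mul_smul]
  · intro k hk
    by_cases hM : k ∈ M <;> simp [normalTerm, hM, show n - k ≠ p by omega]

/-- Reindexing after a shift of the first factor; the set of exponents which are ordered to the
right is shifted too. -/
theorem wNormal_scale_shift_left {M : Set ℤ} {A B : ℤ → Module.End ℂ V} {s : ℤ}
    (h : Admissible {k | k - s ∈ M} A B) (w φ : ℤ → ℂ) (n : ℤ) :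
    wNormal M w (fun k => φ k • A (k + s)) B n =
      wNormal {k | k - s ∈ M} (fun k => w (k - s) * φ (k - s)) A B (n + s) := by
  refine LinearMap.ext fun v => ?_
  rw [wNormal_apply (h.scale_shift_left φ), wNormal_apply h]
  refine Eq.trans (finsum_congr fun k => ?_) (finsum_comp_equiv (Equiv.addRight s))
  by_cases hk : k ∈ M <;> simp [normalTerm, hk, mul_smul]

theorem wNormal_scale_shift_right {M : Set ℤ} {A B : ℤ → Module.End ℂ V}
    (h : Admissible M A B) (w φ : ℤ → ℂ) (n s : ℤ) :
    wNormal M w A (fun k => φ k • B (k + s)) n =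
      wNormal M (fun k => w k * φ (n - k)) A B (n + s) := by
  refine LinearMap.ext fun v => ?_
  rw [wNormal_apply (h.scale_shift_right φ s), wNormal_apply h]
  refine finsum_congr fun k => ?_
  rw [mul_smul]
  by_cases hk : k ∈ M <;> simp [normalTerm, hk, show n - k + s = n + s - k by ring]

/-- Bracketing with an operator is a derivation of normal ordered products. -/
theorem lie_wNormal {M : Set ℤ} {A A' B B' : ℤ → Module.End ℂ V} {Q : Module.End ℂ V}
    (hA : ∀ k, ⁅Q, A k⁆ = A' k) (hB : ∀ k, ⁅Q, B k⁆ = B' k) (h : Admissible M A B)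
    (h₁ : Admissible M A' B) (h₂ : Admissible M A B') (w : ℤ → ℂ) (n : ℤ) :
    ⁅Q, wNormal M w A B n⁆ = wNormal M w A' B n + wNormal M w A B' n := by
  refine LinearMap.ext fun v => ?_
  have e1 : Q (∑ᶠ k, w k • normalTerm M A B n k v) =
      ∑ᶠ k, Q (w k • normalTerm M A B n k v) :=
    Q.toAddMonoidHom.map_finsum (h.finite_support w n v)
  rw [Ring.lie_def, LinearMap.sub_apply, Module.End.mul_apply, Module.End.mul_apply,
    LinearMap.add_apply, wNormal_apply h, wNormal_apply h, wNormal_apply h₁, wNormal_apply h₂,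
    ← finsum_add_distrib (h₁.finite_support w n v) (h₂.finite_support w n v), e1,
    sub_eq_iff_eq_add, ← finsum_add_distrib _ (h.finite_support w n (Q v))]
  · refine finsum_congr fun k => ?_
    rw [map_smul, ← smul_add, ← smul_add]
    congr 1
    have hA' := hA k
    have hB' := hB (n - k)
    rw [Ring.lie_def] at hA' hB'
    by_cases hk : k ∈ M
    · simp only [normalTerm, hk, if_true, ← hA', ← hB', Module.End.mul_apply,
        LinearMap.sub_apply, map_sub]
      abel
    · simp only [normalTerm, hk, if_false, ← hA', ← hB', Module.End.mul_apply,
        LinearMap.sub_apply, map_sub]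
      abel
  · refine ((h₁.finite_support w n v).union (h₂.finite_support w n v)).subset
      (Function.support_add _ _)

/-- The exponents below `c` for `r = 0`, and none for `r = 1`. The usual normal ordering of the
Heisenberg fields is `cut 0 0` for both values of `r`. -/
def cut (r : Fin 2) (c : ℤ) : Set ℤ := {k | r = 0 ∧ k < c}

theorem usual_eq_cut : usual = cut 0 0 := by ext; simp [usual, cut]

theorem alphaMinus_eq_cut (r : Fin 2) : alphaMinus r = cut r 0 := by
  by_cases h : r = 0 <;> ext <;> simp [alphaMinus, usual, cut, h]

theorem cut_shift (r : Fin 2) (c s : ℤ) : {k | k - s ∈ cut r c} = cut r (c + s) := by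
  ext k; simp [cut, sub_lt_iff_lt_add]

/-- Moving the cut between creation and annihilation changes the normal ordered product by a
scalar: the sum of the commutators of the factors which are reordered, telescoped by `F`. -/
theorem wNormal_cut {r : Fin 2} {A B : ℤ → Module.End ℂ V} (h : ∀ c, Admissible (cut r c) A B)
    {w ω F : ℤ → ℂ} {n : ℤ} (hω : ∀ k, ⁅A k, B (n - k)⁆ = ω k • (1 : Module.End ℂ V))
    (hF : ∀ k, F (k + 1) = F k + w k * ω k) (c : ℤ) :
    wNormal (cut r c) w A B n =
      wNormal (cut r 0) w A B n - (if r = 0 then F c - F 0 else 0) • 1 := by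
  have step : ∀ c, wNormal (cut r (c + 1)) w A B n =
      wNormal (cut r c) w A B n - (if r = 0 then F (c + 1) - F c else 0) • 1 := by
    intro c
    by_cases hr : r = 0
    · subst hr
      -- Only the summand with `k = c` is reordered.
      refine LinearMap.ext fun v => ?_
      rw [LinearMap.sub_apply, wNormal_apply (h _), wNormal_apply (h _), if_pos rfl, hF,
        add_sub_cancel_left, eq_sub_iff_add_eq]
      have e : (w c * ω c) • (1 : Module.End ℂ V) v =
          ∑ᶠ k, if k = c then (w c * ω c) • v else 0 := by
        rw [finsum_eq_single _ c (fun k hk => if_neg hk), if_pos rfl]; rfl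
      rw [LinearMap.smul_apply, e, ← finsum_add_distrib ((h (c + 1)).finite_support w n v)
        ((Set.finite_singleton c).subset fun k hk => by
          by_contra hc
          exact hk (if_neg hc))]
      refine finsum_congr fun k => ?_
      rcases lt_trichotomy k c with hk | rfl | hk
      · simp only [normalTerm, cut, Set.mem_ofPred_eq, true_and, hk, hk.ne, show k < c + 1 by omega,
          if_true, if_false, add_zero]
      · have hk' := congrArg (fun T : Module.End ℂ V => w k • T v) (hω k)
        simp only [Ring.lie_def, LinearMap.sub_apply, Module.End.mul_apply, LinearMap.smul_apply,
          Module.End.one_apply] at hk'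
        simp only [normalTerm, cut, Set.mem_ofPred_eq, true_and, lt_add_one, if_true,
          lt_irrefl, if_false, mul_smul, ← hk', smul_sub]
        abel
      · simp only [normalTerm, cut, Set.mem_ofPred_eq, true_and, hk.not_gt, hk.ne',
          show ¬ k < c + 1 by omega, if_false, add_zero]
    · have hc : ∀ c, cut r c = ∅ := fun c => by ext; simp [cut, hr]
      simp [hc, hr]
  induction c using Int.induction_on with
  | zero => simp
  | succ i ih =>
    rw [step, ih]
    by_cases hr : r = 0 <;> simp only [hr, if_true, if_false] <;> module
  | pred i ih =>
    have hs := step (-(i : ℤ) - 1)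
    rw [sub_add_cancel, ih] at hs
    rw [sub_eq_iff_eq_add.1 hs.symm]
    by_cases hr : r = 0 <;> simp only [hr, if_true, if_false] <;> module

/-- Exchanging the two factors reflects the cut. -/
theorem wNormal_swap {A B : ℤ → Module.End ℂ V} (h : ∀ c, Admissible (cut 0 c) A B)
    (h' : ∀ c, Admissible (cut 0 c) B A) (w : ℤ → ℂ) (n c : ℤ) :
    wNormal (cut 0 c) w A B n =
      wNormal (cut 0 (n + 1 - c)) (fun k => w (n - k)) B A n := by
  refine LinearMap.ext fun v => ?_
  rw [wNormal_apply (h _), wNormal_apply (h' _)]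
  refine Eq.trans (finsum_congr fun k => ?_) (finsum_comp_equiv (Equiv.subLeft n))
  by_cases hk : k < c
  · simp [normalTerm, cut, hk, show ¬ n - k < n + 1 - c by omega]
  · simp [normalTerm, cut, hk, show n - k < n + 1 - c by omega]

/-! ### Bilinear expressions in the `βγ` fields -/

/-- The commutation relations of the coefficients of `α(z), α¹(z), α*(z), α¹*(z)`. -/
structure IsBetaGamma (r : Fin 2) (α αs : Fin 2 → ℤ → Module.End ℂ V) : Prop where
  adm : ∀ c i j, Admissible (cut r c) (α i) (αs j)
  lie_left : ∀ i j k l, ⁅α i k, α j l⁆ = 0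
  lie_right : ∀ i j k l, ⁅αs i k, αs j l⁆ = 0
  lie_mixed : ∀ i j k l,
    ⁅α i k, αs j l⁆ = (if l = -1 - k then if i = j then 1 else 0 else 0 : ℂ) • 1

namespace IsBetaGamma

variable {r : Fin 2} {α αs : Fin 2 → ℤ → Module.End ℂ V}

/-- The brackets with `α^k` and `α^{k*}` are single modes, as the modes of the `βγ` fields pair up
one by one. -/
theorem lie_wNormal_left (H : IsBetaGamma r α αs) (i j k : Fin 2) (w : ℤ → ℂ) (m p : ℤ) :
    ⁅wNormal (cut r 0) w (α i) (αs j) m, α k p⁆ =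
      (if j = k then -w (p + (m + 1)) else 0) • α i (p + (m + 1)) := by
  have h := H.adm 0 i j
  rw [← lie_skew, lie_wNormal (Q := α k p) (A' := 0)
    (fun l => H.lie_left k i p l) (fun l => H.lie_mixed k j p l) h h.zero_left
    (h.single_right _ _), wNormal_zero_left h, wNormal_single_right h, zero_add,
    show m - (-1 - p) = p + (m + 1) by ring]
  by_cases hjk : j = k <;> simp [hjk, eq_comm]

theorem lie_wNormal_right (H : IsBetaGamma r α αs) (i j l : Fin 2) (w : ℤ → ℂ) (m q : ℤ) :
    ⁅wNormal (cut r 0) w (α i) (αs j) m, αs l q⁆ =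
      (if i = l then w (-1 - q) else 0) • αs j (q + (m + 1)) := by
  have h := H.adm 0 i j
  have hA : ∀ k, ⁅αs l q, α i k⁆ =
      (if k = -1 - q then (if i = l then -1 else 0) else 0 : ℂ) • 1 := fun k => by
    rw [← lie_skew, H.lie_mixed, ← neg_smul]
    congr 1
    by_cases hk : k = -1 - q
    · simp [hk, apply_ite]
    · simp [hk, show q ≠ -1 - k by omega]
  rw [← lie_skew, lie_wNormal (Q := αs l q) (B' := 0) hA
    (fun k => H.lie_right l j q k) h (h.single_left _ _) h.zero_right, wNormal_zero_right h,
    wNormal_single_left h, add_zero, show m - (-1 - q) = q + (m + 1) by ring]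
  by_cases hjk : i = l <;> simp [hjk]

/-- The normal ordered bilinear expressions in the `βγ` fields are closed under the bracket, up to
a scalar which comes from a double contraction. The function `F` sums the product of weights. -/
theorem lie_wNormal_wNormal (H : IsBetaGamma r α αs) (i j k l : Fin 2) (f g F : ℤ → ℂ) (m n : ℤ)
    (hF : ∀ p, F (p + 1) = F p + f p * g (p - (m + 1))) :
    ⁅wNormal (cut r 0) f (α i) (αs j) m, wNormal (cut r 0) g (α k) (αs l) n⁆ =
      (if i = l then 1 else 0 : ℂ) •
        wNormal (cut r 0) (fun p => g p * f (p - (n + 1))) (α k) (αs j) (m + n + 1)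
      - (if j = k then 1 else 0 : ℂ) •
        wNormal (cut r 0) (fun p => f p * g (p - (m + 1))) (α i) (αs l) (m + n + 1)
      + ((if j = k then 1 else 0) * (if i = l then 1 else 0) *
          (if r = 0 then if m + n + 1 = -1 then F (m + 1) - F 0 else 0 else 0) : ℂ) • 1 := by
  have h := H.adm
  have h₁ : Admissible {p | p - (m + 1) ∈ cut r 0} (α i) (αs l) := by
    rw [cut_shift]; exact h _ _ _
  -- The derivation rule for the first factor shifts the cut by `m + 1`.
  have hcut := wNormal_cut (fun c => h c i l) (w := fun p => f p * g (p - (m + 1)))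
    (ω := fun _ => if m + n + 1 = -1 then if i = l then 1 else 0 else 0)
    (F := fun p => if m + n + 1 = -1 then if i = l then F p else 0 else 0) (n := m + n + 1)
    (fun p => by
      rw [H.lie_mixed]
      congr 1
      exact if_congr (by omega) rfl rfl)
    (fun p => by
      by_cases h1 : m + n + 1 = -1 <;> by_cases h2 : i = l <;> simp [h1, h2, hF])
    (m + 1)
  rw [lie_wNormal (fun p => H.lie_wNormal_left i j k f m p)
    (fun p => H.lie_wNormal_right i j l f m p) (h 0 k l)
    (h₁.scale_shift_left _) ((h 0 k j).scale_shift_right _ _),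
    wNormal_scale_shift_left h₁, wNormal_scale_shift_right (h 0 k j), cut_shift, zero_add,
    show n + (m + 1) = m + n + 1 by ring]
  have e1 : (fun p => g (p - (m + 1)) * if j = k then -f (p - (m + 1) + (m + 1)) else 0) =
      fun p => (if j = k then -1 else 0) * (f p * g (p - (m + 1))) := by
    funext p
    rw [sub_add_cancel]
    by_cases hjk : j = k <;> simp [hjk, mul_comm]
  have e2 : (fun p => g p * if i = l then f (-1 - (n - p)) else 0) =
      fun p => (if i = l then 1 else 0) * (g p * f (p - (n + 1))) := by
    funext p
    rw [show -1 - (n - p) = p - (n + 1) by ring]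
    by_cases hjk : i = l <;> simp [hjk]
  rw [e1, e2, wNormal_smul_weight (h _ _ _), wNormal_smul_weight (h _ _ _), hcut]
  by_cases h1 : j = k <;> by_cases h2 : i = l <;> by_cases h3 : r = 0 <;>
    by_cases h4 : m + n + 1 = -1 <;>
    simp only [h1, h2, h3, h4, if_true, if_false] <;> module

end IsBetaGamma

/-- The sum of the terms `k ^ t :A k * B (n - k):`. -/
def powNormal (r : Fin 2) (A B : ℤ → Module.End ℂ V) (t : ℕ) (n : ℤ) : Module.End ℂ V :=
  wNormal (cut r 0) (fun k => (k : ℂ) ^ t) A B n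

theorem wNormal_quadratic {r : Fin 2} {A B : ℤ → Module.End ℂ V} (h : Admissible (cut r 0) A B)
    (a b c : ℂ) (n : ℤ) :
    wNormal (cut r 0) (fun k => a + b * k + c * k ^ 2) A B n =
      a • powNormal r A B 0 n + b • powNormal r A B 1 n + c • powNormal r A B 2 n := by
  simp only [powNormal]
  rw [← wNormal_smul_weight h, ← wNormal_smul_weight h, ← wNormal_smul_weight h,
    ← wNormal_add_weight h, ← wNormal_add_weight h]
  simp

theorem wNormal_linear {r : Fin 2} {A B : ℤ → Module.End ℂ V} (h : Admissible (cut r 0) A B)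
    (a b : ℂ) (n : ℤ) :
    wNormal (cut r 0) (fun k => a + b * k) A B n =
      a • powNormal r A B 0 n + b • powNormal r A B 1 n := by
  simp only [powNormal]
  rw [← wNormal_smul_weight h, ← wNormal_smul_weight h, ← wNormal_add_weight h]
  simp

/-- The polynomial in `p` whose value at a natural number is the sum of `a + b k + c k²` over
`0 ≤ k < p`. -/
def quadSum (a b c : ℂ) (p : ℂ) : ℂ :=
  a * p + b * (p * (p - 1) / 2) + c * (p * (p - 1) * (2 * p - 1) / 6)

/-- The normal ordered product `∑ (f₀ + f₁ k) :A k * B (n - k):`. -/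
def linNormal (r : Fin 2) (A B : ℤ → Module.End ℂ V) (f₀ f₁ : ℂ) (n : ℤ) : Module.End ℂ V :=
  f₀ • powNormal r A B 0 n + f₁ • powNormal r A B 1 n

namespace IsBetaGamma

variable {r : Fin 2} {α αs : Fin 2 → ℤ → Module.End ℂ V}

theorem lie_linNormal (H : IsBetaGamma r α αs) (i j k l : Fin 2) (f₀ f₁ g₀ g₁ : ℂ) (m n : ℤ) :
    ⁅linNormal r (α i) (αs j) f₀ f₁ m, linNormal r (α k) (αs l) g₀ g₁ n⁆ =
      (if i = l then 1 else 0 : ℂ) • (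
        (g₀ * (f₀ - f₁ * (n + 1))) • powNormal r (α k) (αs j) 0 (m + n + 1)
        + (g₀ * f₁ + g₁ * (f₀ - f₁ * (n + 1))) • powNormal r (α k) (αs j) 1 (m + n + 1)
        + (g₁ * f₁) • powNormal r (α k) (αs j) 2 (m + n + 1))
      - (if j = k then 1 else 0 : ℂ) • (
        (f₀ * (g₀ - g₁ * (m + 1))) • powNormal r (α i) (αs l) 0 (m + n + 1)
        + (f₀ * g₁ + f₁ * (g₀ - g₁ * (m + 1))) • powNormal r (α i) (αs l) 1 (m + n + 1)
        + (f₁ * g₁) • powNormal r (α i) (αs l) 2 (m + n + 1))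
      + ((if j = k then 1 else 0) * (if i = l then 1 else 0) *
          (if r = 0 then if m + n + 1 = -1 then
            quadSum (f₀ * (g₀ - g₁ * (m + 1))) (f₀ * g₁ + f₁ * (g₀ - g₁ * (m + 1))) (f₁ * g₁)
              (m + 1) else 0 else 0) : ℂ) • 1 := by
  have h := H.adm 0
  rw [linNormal, linNormal, ← wNormal_linear (h _ _), ← wNormal_linear (h _ _),
    H.lie_wNormal_wNormal i j k l _ _ (fun p =>
      quadSum (f₀ * (g₀ - g₁ * (m + 1))) (f₀ * g₁ + f₁ * (g₀ - g₁ * (m + 1))) (f₁ * g₁) p)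
      m n (fun p => by simp only [quadSum]; push_cast; ring),
    ← wNormal_quadratic (h _ _), ← wNormal_quadratic (h _ _)]
  congr 1
  · congr 3
    · funext p; push_cast; ring
    · funext p; push_cast; ring
  · have h0 : ∀ a b c, quadSum a b c ((0 : ℤ) : ℂ) = 0 := fun a b c => by simp [quadSum]
    rw [h0, sub_zero]
    push_cast
    rfl

end IsBetaGamma

/-- The coefficient of `z ^ n` of the `βγ` part of `d̄(z)`. The first two summands come from the
leading terms of `P = z² + 4z` and `P' / 2 = z + 2`, the other two from the remaining terms. -/
def bgL (r : Fin 2) (α αs : Fin 2 → ℤ → Module.End ℂ V) (n : ℤ) : Module.End ℂ V :=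
  linNormal r (α 0) (αs 0) (n - 1) (-1) (n - 1) + linNormal r (α 1) (αs 1) n (-1) (n - 1)
    + linNormal r (α 0) (αs 0) (4 * n) (-4) n + linNormal r (α 1) (αs 1) (4 * n + 2) (-4) n

/-- The coefficient of `z ^ n` of the `βγ` part of `d̄¹(z)`. -/
def bgJ (r : Fin 2) (α αs : Fin 2 → ℤ → Module.End ℂ V) (n : ℤ) : Module.End ℂ V :=
  linNormal r (α 1) (αs 0) (n + 1) (-1) (n + 1) + linNormal r (α 0) (αs 1) n (-1) (n - 1)
    + linNormal r (α 0) (αs 1) (4 * n + 2) (-4) n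

/-- The value of `φ₁` on the coefficients of `z ^ m` and `z ^ n` of `d̄(z)`. -/
def cocycleL (m n : ℤ) : ℂ :=
  -((n : ℂ) ^ 3 - n) * (if m + n = 0 then 1 else 0)
    - 4 * n * (n + 1) * (2 * n + 1) * (if m + n = -1 then 1 else 0)
    - 4 * (n + 1) * (2 * n + 1) * (2 * n + 3) * (if m + n = -2 then 1 else 0)

/-- The value of `φ₁` on the coefficients of `z ^ m` and `z ^ n` of `d̄¹(z)`. -/
def cocycleJ (m n : ℤ) : ℂ :=
  -(2 * ((n : ℂ) + 1) * (n + 2) * (2 * n + 3)) * (if m + n = -3 then 1 else 0)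
    - (n : ℂ) * (n + 1) * (n + 2) * (if m + n = -2 then 1 else 0)

namespace IsBetaGamma

variable {r : Fin 2} {α αs : Fin 2 → ℤ → Module.End ℂ V}

/-- For `r = 0` each of the two `βγ` systems contributes a double contraction; for `r = 1` there is
none. -/
theorem lie_bgL_bgL (H : IsBetaGamma r α αs) (m n : ℤ) :
    ⁅bgL r α αs m, bgL r α αs n⁆ =
      ((n : ℂ) - m) • (bgL r α αs (m + n) + (4 : ℂ) • bgL r α αs (m + n + 1))
        + (-(1 / 3) * (if r = 0 then 1 else 0) * cocycleL m n : ℂ) • 1 := by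
  simp only [bgL, add_lie, lie_add, H.lie_linNormal]
  simp only [linNormal,
    show m - 1 + (n - 1) + 1 = m + n - 1 by ring, show m - 1 + n + 1 = m + n by ring,
    show m + (n - 1) + 1 = m + n by ring, show m + n + 1 - 1 = m + n by ring, cocycleL,
    if_true, Fin.isValue, zero_ne_one, one_ne_zero, if_false, quadSum]
  by_cases hr : r = 0
  · simp only [hr, if_true]
    by_cases h0 : m + n = 0
    · obtain rfl : n = -m := by omega
      simp (disch := omega) only [if_pos, if_neg]
      push_cast
      module
    by_cases h1 : m + n = -1
    · obtain rfl : n = -1 - m := by omega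
      simp (disch := omega) only [if_pos, if_neg]
      push_cast
      module
    by_cases h2 : m + n = -2
    · obtain rfl : n = -2 - m := by omega
      simp (disch := omega) only [if_pos, if_neg]
      push_cast
      module
    simp (disch := omega) only [if_neg]
    push_cast
    module
  · simp only [hr, if_false]
    push_cast
    module

theorem lie_bgL_bgJ (H : IsBetaGamma r α αs) (m n : ℤ) :
    ⁅bgL r α αs m, bgJ r α αs n⁆ =
      ((n : ℂ) - m + 1) • bgJ r α αs (m + n)
        + (4 * (n : ℂ) - 4 * m + 2) • bgJ r α αs (m + n + 1) := by
  simp only [bgL, bgJ, add_lie, lie_add, H.lie_linNormal]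
  simp only [linNormal,
    show m - 1 + (n - 1) + 1 = m + n - 1 by ring, show m - 1 + n + 1 = m + n by ring,
    show m + (n - 1) + 1 = m + n by ring, show m + n + 1 - 1 = m + n by ring,
    show m - 1 + (n + 1) + 1 = m + n + 1 by ring, show m + (n + 1) + 1 = m + n + 1 + 1 by ring,
    if_true, Fin.isValue, zero_ne_one, one_ne_zero, if_false, zero_mul, mul_zero]
  push_cast
  module

theorem lie_bgJ_bgJ (H : IsBetaGamma r α αs) (m n : ℤ) :
    ⁅bgJ r α αs m, bgJ r α αs n⁆ =
      ((n : ℂ) - m) • bgL r α αs (m + n + 2)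
        + (-(1 / 3) * (if r = 0 then 1 else 0) * cocycleJ m n : ℂ) • 1 := by
  simp only [bgL, bgJ, add_lie, lie_add, H.lie_linNormal]
  simp only [linNormal,
    show m + 1 + (n - 1) + 1 = m + n + 1 by ring, show m - 1 + (n + 1) + 1 = m + n + 1 by ring,
    show m + (n + 1) + 1 = m + n + 2 by ring, show m + 1 + n + 1 = m + n + 2 by ring,
    show m + n + 2 - 1 = m + n + 1 by ring, cocycleJ,
    if_true, Fin.isValue, zero_ne_one, one_ne_zero, if_false, quadSum, zero_mul, mul_zero]
  by_cases hr : r = 0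
  · simp only [hr, if_true]
    by_cases h1 : m + n = -3
    · obtain rfl : n = -3 - m := by omega
      simp (disch := omega) only [if_pos, if_neg]
      push_cast
      module
    by_cases h2 : m + n = -2
    · obtain rfl : n = -2 - m := by omega
      simp (disch := omega) only [if_pos, if_neg]
      push_cast
      module
    simp (disch := omega) only [if_neg]
    push_cast
    module
  · simp only [hr, if_false]
    push_cast
    module

end IsBetaGamma

/-! ### Quadratic expressions in the Heisenberg fields -/

/-- Bracketing an unweighted normal ordered product with an operator which acts on the factors by
combinations of two shifts with affine coefficients. -/
theorem lie_powNormal_zero {r : Fin 2} {A A₁ A₂ B B₁ B₂ : ℤ → Module.End ℂ V} {Q : Module.End ℂ V}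
    {a₁ b₁ a₂ b₂ c₁ d₁ c₂ d₂ : ℂ} {s₁ s₂ t₁ t₂ : ℤ}
    (hA : ∀ k : ℤ, ⁅Q, A k⁆ = (a₁ + b₁ * k) • A₁ (k + s₁) + (a₂ + b₂ * k) • A₂ (k + s₂))
    (hB : ∀ k : ℤ, ⁅Q, B k⁆ = (c₁ + d₁ * k) • B₁ (k + t₁) + (c₂ + d₂ * k) • B₂ (k + t₂))
    (h : Admissible (cut r 0) A B) (hA₁ : ∀ c, Admissible (cut r c) A₁ B)
    (hA₂ : ∀ c, Admissible (cut r c) A₂ B)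
    (hB₁ : Admissible (cut r 0) A B₁) (hB₂ : Admissible (cut r 0) A B₂) (n : ℤ) :
    ⁅Q, powNormal r A B 0 n⁆ =
      wNormal (cut r s₁) (fun k => (a₁ - b₁ * s₁) + b₁ * k) A₁ B (n + s₁)
      + wNormal (cut r s₂) (fun k => (a₂ - b₂ * s₂) + b₂ * k) A₂ B (n + s₂)
      + ((c₁ + d₁ * n) • powNormal r A B₁ 0 (n + t₁) - d₁ • powNormal r A B₁ 1 (n + t₁))
      + ((c₂ + d₂ * n) • powNormal r A B₂ 0 (n + t₂) - d₂ • powNormal r A B₂ 1 (n + t₂)) := by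
  have h₁ : Admissible {p | p - s₁ ∈ cut r 0} A₁ B := by rw [cut_shift]; exact hA₁ _
  have h₂ : Admissible {p | p - s₂ ∈ cut r 0} A₂ B := by rw [cut_shift]; exact hA₂ _
  have k₁ := h₁.scale_shift_left (fun k => a₁ + b₁ * k)
  have k₂ := h₂.scale_shift_left (fun k => a₂ + b₂ * k)
  have l₁ := hB₁.scale_shift_right (fun k => c₁ + d₁ * k) t₁
  have l₂ := hB₂.scale_shift_right (fun k => c₂ + d₂ * k) t₂
  have e : ∀ c d : ℂ, (fun k : ℤ => (k : ℂ) ^ 0 * (c + d * ((n - k : ℤ) : ℂ))) =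
      fun k : ℤ => (c + d * n) + (-d) * k := fun c d => by
    funext k; push_cast; ring
  rw [powNormal, lie_wNormal hA hB h (k₁.add_left k₂) (l₁.add_right l₂), wNormal_add_left k₁ k₂,
    wNormal_add_right l₁ l₂, wNormal_scale_shift_left h₁, wNormal_scale_shift_left h₂,
    wNormal_scale_shift_right hB₁, wNormal_scale_shift_right hB₂, e, e, wNormal_linear hB₁,
    wNormal_linear hB₂, cut_shift, cut_shift, zero_add, zero_add, ← add_assoc, neg_smul, neg_smul,
    ← sub_eq_add_neg, ← sub_eq_add_neg]
  congr 4
  · funext k; push_cast; ring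
  · funext k; push_cast; ring

/-- The commutation relations of the coefficients of `β(z)` and `β¹(z)`, indexed by the exponents of
`z`: the modes are `b_n` with `n = -k - 1`. -/
structure IsHeisenberg (κ : ℂ) (β β₁ : ℤ → Module.End ℂ V) : Prop where
  adm₀₀ : ∀ c, Admissible (cut 0 c) β β
  adm₀₁ : ∀ c, Admissible (cut 0 c) β β₁
  adm₁₁ : ∀ c, Admissible (cut 0 c) β₁ β₁
  lie₀₀ : ∀ k l : ℤ, ⁅β k, β l⁆ = (if l = -2 - k then 2 * (k + 1) * κ else 0 : ℂ) • 1
  lie₁₁ : ∀ k l : ℤ, ⁅β₁ k, β₁ l⁆ = (if l = -k then 2 * k * κ else 0 : ℂ) • 1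
    + (if l = -1 - k then 4 * (2 * k + 1) * κ else 0 : ℂ) • 1
  lie₀₁ : ∀ k l : ℤ, ⁅β k, β₁ l⁆ = 0

/-- The coefficient of `z ^ n` of the Heisenberg part of `d̄(z)`. -/
def heisL (κ : ℂ) (β β₁ : ℤ → Module.End ℂ V) (n : ℤ) : Module.End ℂ V :=
  (-1 / (4 * κ)) • (powNormal 0 β β 0 (n - 2) + (4 : ℂ) • powNormal 0 β β 0 (n - 1)
    + powNormal 0 β₁ β₁ 0 n)

/-- The coefficient of `z ^ n` of the Heisenberg part of `d̄¹(z)`. -/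
def heisJ (ν : ℂ) (β β₁ : ℤ → Module.End ℂ V) (n : ℤ) : Module.End ℂ V :=
  ν • powNormal 0 β β₁ 0 n

namespace IsHeisenberg

variable {κ ν : ℂ} {β β₁ : ℤ → Module.End ℂ V}

theorem lie₁₀ (H : IsHeisenberg κ β β₁) (k l : ℤ) : ⁅β₁ k, β l⁆ = 0 := by
  rw [← lie_skew, H.lie₀₁, neg_zero]

theorem lie_pow₀₀_left (H : IsHeisenberg κ β β₁) (n p : ℤ) :
    ⁅powNormal 0 β β 0 n, β p⁆ = (-(4 * (p + 1) * κ)) • β (p + (n + 2)) := by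
  have h := H.adm₀₀ 0
  rw [powNormal, ← lie_skew, lie_wNormal (H.lie₀₀ p) (H.lie₀₀ p) h (h.single_left _ _)
    (h.single_right _ _), wNormal_single_left h, wNormal_single_right h,
    show n - (-2 - p) = p + (n + 2) by ring]
  module

theorem lie_pow₀₀_right (H : IsHeisenberg κ β β₁) (n p : ℤ) :
    ⁅powNormal 0 β β 0 n, β₁ p⁆ = 0 := by
  have h := H.adm₀₀ 0
  rw [powNormal, ← lie_skew, lie_wNormal (A' := 0) (B' := 0) (H.lie₁₀ p) (H.lie₁₀ p) h h.zero_left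
    h.zero_right, wNormal_zero_left h, wNormal_zero_right h, add_zero, neg_zero]

theorem lie_pow₁₁_left (H : IsHeisenberg κ β β₁) (n p : ℤ) :
    ⁅powNormal 0 β₁ β₁ 0 n, β p⁆ = 0 := by
  have h := H.adm₁₁ 0
  rw [powNormal, ← lie_skew, lie_wNormal (A' := 0) (B' := 0) (H.lie₀₁ p) (H.lie₀₁ p) h h.zero_left
    h.zero_right, wNormal_zero_left h, wNormal_zero_right h, add_zero, neg_zero]

theorem lie_pow₁₁_right (H : IsHeisenberg κ β β₁) (n p : ℤ) :
    ⁅powNormal 0 β₁ β₁ 0 n, β₁ p⁆ =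
      (-(4 * p * κ)) • β₁ (p + n) + (-(8 * (2 * p + 1) * κ)) • β₁ (p + (n + 1)) := by
  have h := H.adm₁₁ 0
  rw [powNormal, ← lie_skew, lie_wNormal (H.lie₁₁ p) (H.lie₁₁ p) h
    ((h.single_left _ _).add_left (h.single_left _ _))
    ((h.single_right _ _).add_right (h.single_right _ _)),
    wNormal_add_left (h.single_left _ _) (h.single_left _ _),
    wNormal_add_right (h.single_right _ _) (h.single_right _ _),
    wNormal_single_left h, wNormal_single_right h, wNormal_single_left h, wNormal_single_right h,
    show n - -p = p + n by ring, show n - (-1 - p) = p + (n + 1) by ring]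
  module

theorem lie_pow₀₁_left (H : IsHeisenberg κ β β₁) (n p : ℤ) :
    ⁅powNormal 0 β β₁ 0 n, β p⁆ = (-(2 * (p + 1) * κ)) • β₁ (p + (n + 2)) := by
  have h := H.adm₀₁ 0
  rw [powNormal, ← lie_skew, lie_wNormal (B' := 0) (H.lie₀₀ p) (H.lie₀₁ p) h (h.single_left _ _)
    h.zero_right, wNormal_single_left h, wNormal_zero_right h,
    show n - (-2 - p) = p + (n + 2) by ring]
  module

theorem lie_pow₀₁_right (H : IsHeisenberg κ β β₁) (n p : ℤ) :
    ⁅powNormal 0 β β₁ 0 n, β₁ p⁆ =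
      (-(2 * p * κ)) • β (p + n) + (-(4 * (2 * p + 1) * κ)) • β (p + (n + 1)) := by
  have h := H.adm₀₁ 0
  rw [powNormal, ← lie_skew, lie_wNormal (A' := 0) (H.lie₁₀ p) (H.lie₁₁ p) h h.zero_left
    ((h.single_right _ _).add_right (h.single_right _ _)), wNormal_zero_left h,
    wNormal_add_right (h.single_right _ _) (h.single_right _ _),
    wNormal_single_right h, wNormal_single_right h,
    show n - -p = p + n by ring, show n - (-1 - p) = p + (n + 1) by ring]
  module

theorem wNormal_cut₀₀ (H : IsHeisenberg κ β β₁) (a b : ℂ) (c n : ℤ) :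
    wNormal (cut 0 c) (fun k => a + b * k) β β n =
      a • powNormal 0 β β 0 n + b • powNormal 0 β β 1 n
        - (κ * if n = -2 then quadSum (2 * a) (2 * a + 2 * b) (2 * b) c else 0) • 1 := by
  rw [wNormal_cut H.adm₀₀ (ω := fun k => if n = -2 then 2 * (k + 1) * κ else 0)
    (F := fun k => κ * if n = -2 then quadSum (2 * a) (2 * a + 2 * b) (2 * b) k else 0)
    (fun k => by
      rw [H.lie₀₀]
      congr 1
      exact if_congr (by omega) rfl rfl)
    (fun k => by
      by_cases hn : n = -2 <;> simp only [hn, if_true, if_false, quadSum] <;> push_cast <;> ring),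
    wNormal_linear (H.adm₀₀ 0)]
  simp [quadSum]

theorem wNormal_cut₁₁ (H : IsHeisenberg κ β β₁) (a b : ℂ) (c n : ℤ) :
    wNormal (cut 0 c) (fun k => a + b * k) β₁ β₁ n =
      a • powNormal 0 β₁ β₁ 0 n + b • powNormal 0 β₁ β₁ 1 n
        - (κ * ((if n = 0 then quadSum 0 (2 * a) (2 * b) c else 0)
          + if n = -1 then quadSum (4 * a) (8 * a + 4 * b) (8 * b) c else 0)) • 1 := by
  rw [wNormal_cut H.adm₁₁ (ω := fun k => (if n = 0 then 2 * k * κ else 0)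
      + (if n = -1 then 4 * (2 * k + 1) * κ else 0))
    (F := fun k => κ * ((if n = 0 then quadSum 0 (2 * a) (2 * b) k else 0)
          + if n = -1 then quadSum (4 * a) (8 * a + 4 * b) (8 * b) k else 0))
    (fun k => by
      rw [H.lie₁₁, add_smul]
      congr 2
      · exact if_congr (by omega) rfl rfl
      · exact if_congr (by omega) rfl rfl)
    (fun k => by
      by_cases hn : n = 0 <;> by_cases hn' : n = -1 <;>
        simp only [hn, hn', if_true, if_false, quadSum] <;> push_cast <;> ring),
    wNormal_linear (H.adm₁₁ 0)]
  simp [quadSum]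

theorem wNormal_cut₀₁ (H : IsHeisenberg κ β β₁) (a b : ℂ) (c n : ℤ) :
    wNormal (cut 0 c) (fun k => a + b * k) β β₁ n =
      a • powNormal 0 β β₁ 0 n + b • powNormal 0 β β₁ 1 n := by
  rw [wNormal_cut H.adm₀₁ (ω := 0) (F := 0) (fun k => by rw [H.lie₀₁]; simp) (fun k => by simp),
    wNormal_linear (H.adm₀₁ 0)]
  simp

/-- By the symmetry of `:β(z)²:`, the weight `k` may be replaced by its mean `n / 2`. The factors
which change their order in the reflection commute. -/
theorem pow_one₀₀ (H : IsHeisenberg κ β β₁) (n : ℤ) :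
    powNormal 0 β β 1 n = ((n : ℂ) / 2) • powNormal 0 β β 0 n := by
  have h := wNormal_swap H.adm₀₀ H.adm₀₀ (fun k => 0 + 1 * (k : ℂ)) n 0
  have e : (fun k : ℤ => 0 + 1 * ((n - k : ℤ) : ℂ)) = fun k : ℤ => (n : ℂ) + (-1) * k := by
    funext k; push_cast; ring
  have h0 : (if n = -2 then quadSum (2 * 0) (2 * 0 + 2 * 1) (2 * 1) ((0 : ℤ) : ℂ) else 0) = 0 := by
    simp [quadSum]
  have h1 : (if n = -2 then quadSum (2 * (n : ℂ)) (2 * (n : ℂ) + 2 * -1) (2 * -1)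
      ((n + 1 - 0 : ℤ) : ℂ) else 0) = 0 := by
    by_cases hn : n = -2
    · rw [if_pos hn, hn]; norm_num [quadSum]
    · rw [if_neg hn]
  rw [e, H.wNormal_cut₀₀, H.wNormal_cut₀₀, h0, h1] at h
  have h2 : powNormal 0 β β 1 n = (1 / 2 : ℂ) •
      (((0 : ℂ) • powNormal 0 β β 0 n + (1 : ℂ) • powNormal 0 β β 1 n - (κ * 0) • 1)
        + powNormal 0 β β 1 n) := by module
  rw [h2, h]
  module

theorem pow_one₁₁ (H : IsHeisenberg κ β β₁) (n : ℤ) :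
    powNormal 0 β₁ β₁ 1 n = ((n : ℂ) / 2) • powNormal 0 β₁ β₁ 0 n := by
  have h := wNormal_swap H.adm₁₁ H.adm₁₁ (fun k => 0 + 1 * (k : ℂ)) n 0
  have e : (fun k : ℤ => 0 + 1 * ((n - k : ℤ) : ℂ)) = fun k : ℤ => (n : ℂ) + (-1) * k := by
    funext k; push_cast; ring
  have h0 : (if n = 0 then quadSum 0 (2 * 0) (2 * 1) ((0 : ℤ) : ℂ) else 0)
      + (if n = -1 then quadSum (4 * 0) (8 * 0 + 4 * 1) (8 * 1) ((0 : ℤ) : ℂ) else 0) = 0 := by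
    simp [quadSum]
  have h1 : (if n = 0 then quadSum 0 (2 * (n : ℂ)) (2 * -1) ((n + 1 - 0 : ℤ) : ℂ) else 0)
      + (if n = -1 then quadSum (4 * (n : ℂ)) (8 * (n : ℂ) + 4 * -1) (8 * -1)
        ((n + 1 - 0 : ℤ) : ℂ) else 0) = 0 := by
    by_cases hn : n = 0
    · simp [hn, quadSum]
    · by_cases hn' : n = -1
      · simp [hn', quadSum]
      · simp [hn, hn']
  rw [e, H.wNormal_cut₁₁, H.wNormal_cut₁₁, h0, h1] at h
  have h2 : powNormal 0 β₁ β₁ 1 n = (1 / 2 : ℂ) •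
      (((0 : ℂ) • powNormal 0 β₁ β₁ 0 n + (1 : ℂ) • powNormal 0 β₁ β₁ 1 n - (κ * 0) • 1)
        + powNormal 0 β₁ β₁ 1 n) := by module
  rw [h2, h]
  module

theorem lie_heisL_left (H : IsHeisenberg κ β β₁) (hκ : κ ≠ 0) (m k : ℤ) :
    ⁅heisL κ β β₁ m, β k⁆ =
      (1 + 1 * (k : ℂ)) • β (k + m) + (4 + 4 * (k : ℂ)) • β (k + (m + 1)) := by
  simp only [heisL, smul_lie, add_lie, H.lie_pow₀₀_left, H.lie_pow₁₁_left,
    show m - 2 + 2 = m by ring, show m - 1 + 2 = m + 1 by ring]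
  match_scalars <;> field_simp <;> ring

theorem lie_heisL_right (H : IsHeisenberg κ β β₁) (hκ : κ ≠ 0) (m k : ℤ) :
    ⁅heisL κ β β₁ m, β₁ k⁆ =
      (0 + 1 * (k : ℂ)) • β₁ (k + m) + (2 + 4 * (k : ℂ)) • β₁ (k + (m + 1)) := by
  simp only [heisL, smul_lie, add_lie, H.lie_pow₀₀_right, H.lie_pow₁₁_right]
  match_scalars <;> field_simp <;> ring

/-- The second, vanishing term gives the bracket the shape required by `lie_powNormal_zero`. -/
theorem lie_heisJ_left (H : IsHeisenberg κ β β₁) (m k : ℤ) :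
    ⁅heisJ ν β β₁ m, β k⁆ =
      (-(2 * ν * κ) + -(2 * ν * κ) * (k : ℂ)) • β₁ (k + (m + 2))
        + (0 + 0 * (k : ℂ)) • β₁ (k + 0) := by
  simp only [heisJ, smul_lie, H.lie_pow₀₁_left]
  module

theorem lie_heisJ_right (H : IsHeisenberg κ β β₁) (m k : ℤ) :
    ⁅heisJ ν β β₁ m, β₁ k⁆ =
      (0 + -(2 * ν * κ) * (k : ℂ)) • β (k + m)
        + (-(4 * ν * κ) + -(8 * ν * κ) * (k : ℂ)) • β (k + (m + 1)) := by
  simp only [heisJ, smul_lie, H.lie_pow₀₁_right]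
  module

theorem lie_heisL_heisL (H : IsHeisenberg κ β β₁) (hκ : κ ≠ 0) (m n : ℤ) :
    ⁅heisL κ β β₁ m, heisL κ β β₁ n⁆ =
      ((n : ℂ) - m) • (heisL κ β β₁ (m + n) + (4 : ℂ) • heisL κ β β₁ (m + n + 1))
        + (-(1 / 6) * cocycleL m n : ℂ) • 1 := by
  have h₀ := lie_powNormal_zero (H.lie_heisL_left hκ m) (H.lie_heisL_left hκ m) (H.adm₀₀ 0)
    H.adm₀₀ H.adm₀₀ (H.adm₀₀ 0) (H.adm₀₀ 0)
  have h₁ := lie_powNormal_zero (H.lie_heisL_right hκ m) (H.lie_heisL_right hκ m) (H.adm₁₁ 0)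
    H.adm₁₁ H.adm₁₁ (H.adm₁₁ 0) (H.adm₁₁ 0)
  conv_lhs => rw [heisL.eq_def κ β β₁ n]
  simp only [lie_smul, lie_add, h₀, h₁, H.wNormal_cut₀₀, H.wNormal_cut₁₁]
  simp only [heisL, show n - 2 + m = m + n - 2 by ring,
    show n - 2 + (m + 1) = m + n - 1 by ring, show n - 1 + m = m + n - 1 by ring,
    show n - 1 + (m + 1) = m + n by ring, show n + m = m + n by ring,
    show n + (m + 1) = m + n + 1 by ring, show m + n + 1 - 2 = m + n - 1 by ring,
    show m + n + 1 - 1 = m + n by ring, cocycleL, quadSum]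
  by_cases h0 : m + n = 0
  · obtain rfl : n = -m := by omega
    simp (disch := omega) only [if_pos, if_neg]
    push_cast
    match_scalars <;> field_simp <;> ring
  by_cases h1 : m + n = -1
  · obtain rfl : n = -1 - m := by omega
    simp (disch := omega) only [if_pos, if_neg]
    push_cast
    match_scalars <;> field_simp <;> ring
  by_cases h2 : m + n = -2
  · obtain rfl : n = -2 - m := by omega
    simp (disch := omega) only [if_pos, if_neg]
    push_cast
    match_scalars <;> field_simp <;> ring
  simp (disch := omega) only [if_neg]
  push_cast
  match_scalars <;> field_simp <;> ring

theorem lie_heisL_heisJ (H : IsHeisenberg κ β β₁) (hκ : κ ≠ 0) (m n : ℤ) :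
    ⁅heisL κ β β₁ m, heisJ ν β β₁ n⁆ =
      ((n : ℂ) - m + 1) • heisJ ν β β₁ (m + n)
        + (4 * (n : ℂ) - 4 * m + 2) • heisJ ν β β₁ (m + n + 1) := by
  rw [heisJ, lie_smul, lie_powNormal_zero (H.lie_heisL_left hκ m) (H.lie_heisL_right hκ m)
    (H.adm₀₁ 0) H.adm₀₁ H.adm₀₁ (H.adm₀₁ 0) (H.adm₀₁ 0)]
  simp only [H.wNormal_cut₀₁, heisJ, show n + m = m + n by ring,
    show n + (m + 1) = m + n + 1 by ring]
  push_cast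
  module

theorem lie_heisJ_heisJ (H : IsHeisenberg κ β β₁) (hκ : κ ≠ 0) (hν : ν ^ 2 = 1 / (4 * κ ^ 2))
    (m n : ℤ) :
    ⁅heisJ ν β β₁ m, heisJ ν β β₁ n⁆ =
      ((n : ℂ) - m) • heisL κ β β₁ (m + n + 2) + (-(1 / 6) * cocycleJ m n : ℂ) • 1 := by
  have hJ := lie_powNormal_zero (H.lie_heisJ_left (ν := ν) m) (H.lie_heisJ_right (ν := ν) m)
    (H.adm₀₁ 0) H.adm₁₁ H.adm₁₁ (H.adm₀₀ 0) (H.adm₀₀ 0) n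
  conv_lhs => rw [heisJ.eq_def ν β β₁ n]
  have hz : wNormal (cut 0 0) (fun k : ℤ => (0 : ℂ) - 0 * ((0 : ℤ) : ℂ) + 0 * (k : ℂ)) β₁ β₁
      (n + 0) = 0 := by
    simpa using wNormal_smul_weight (H.adm₁₁ 0) 0 (fun _ => 0) (n + 0)
  rw [lie_smul, hJ, hz]
  simp only [H.wNormal_cut₁₁, H.pow_one₀₀, H.pow_one₁₁, heisL,
    show n + (m + 2) = m + n + 2 by ring, show n + m = m + n by ring,
    show n + (m + 1) = m + n + 1 by ring, show m + n + 2 - 2 = m + n by ring,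
    show m + n + 2 - 1 = m + n + 1 by ring, cocycleJ, quadSum]
  -- The sign of `ν` is irrelevant, since the bracket is quadratic in `ν`.
  have hν' : ν = 1 / (2 * κ) ∨ ν = -1 / (2 * κ) := by
    have : (ν - 1 / (2 * κ)) * (ν - -1 / (2 * κ)) = 0 := by
      field_simp at hν ⊢
      linear_combination hν
    rcases mul_eq_zero.1 this with h | h
    · exact Or.inl (sub_eq_zero.1 h)
    · exact Or.inr (sub_eq_zero.1 h)
  rcases hν' with rfl | rfl
  all_goals
    by_cases h1 : m + n = -3
    · obtain rfl : n = -3 - m := by omega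
      simp (disch := omega) only [if_pos, if_neg]
      push_cast
      match_scalars <;> field_simp <;> ring
    by_cases h2 : m + n = -2
    · obtain rfl : n = -2 - m := by omega
      simp (disch := omega) only [if_pos, if_neg]
      push_cast
      match_scalars <;> field_simp <;> ring
    simp (disch := omega) only [if_neg]
    push_cast
    match_scalars <;> field_simp <;> ring

end IsHeisenberg

/-! ### The combined fields -/

theorem lie_wNormal_wNormal_eq_zero {M M' : Set ℤ} {A B A' B' : ℤ → Module.End ℂ V}
    (h : Admissible M A B) (h' : Admissible M' A' B')
    (h₁ : ∀ k l, ⁅A k, A' l⁆ = 0) (h₂ : ∀ k l, ⁅A k, B' l⁆ = 0)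
    (h₃ : ∀ k l, ⁅B k, A' l⁆ = 0) (h₄ : ∀ k l, ⁅B k, B' l⁆ = 0) (w w' : ℤ → ℂ) (m n : ℤ) :
    ⁅wNormal M w A B m, wNormal M' w' A' B' n⁆ = 0 := by
  have key : ∀ X : Module.End ℂ V, (∀ k, ⁅A k, X⁆ = 0) → (∀ k, ⁅B k, X⁆ = 0) →
      ⁅wNormal M w A B m, X⁆ = 0 := by
    intro X hA hB
    rw [← lie_skew, lie_wNormal (A' := 0) (B' := 0)
      (fun k => by rw [← lie_skew, hA, neg_zero]; rfl)
      (fun k => by rw [← lie_skew, hB, neg_zero]; rfl) h h.zero_left h.zero_right,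
      wNormal_zero_left h, wNormal_zero_right h, add_zero, neg_zero]
  rw [lie_wNormal (A' := 0) (B' := 0) (fun l => key _ (fun k => h₁ k l) (fun k => h₃ k l))
    (fun l => key _ (fun k => h₂ k l) (fun k => h₄ k l)) h' h'.zero_left h'.zero_right,
    wNormal_zero_left h', wNormal_zero_right h', add_zero]

/-- The commutation relations of the 3-point Virasoro algebra for the coefficients of two fields
`d̄(z)` and `d̄¹(z)`, where `c̄` acts by `C` and `c₁` by zero. -/
structure IsVirasoroPair (C : ℂ) (L J : ℤ → Module.End ℂ V) : Prop where
  lie_L_L : ∀ m n : ℤ, ⁅L m, L n⁆ =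
    ((n : ℂ) - m) • (L (m + n) + (4 : ℂ) • L (m + n + 1)) + (C * cocycleL m n) • 1
  lie_L_J : ∀ m n : ℤ, ⁅L m, J n⁆ =
    ((n : ℂ) - m + 1) • J (m + n) + (4 * (n : ℂ) - 4 * m + 2) • J (m + n + 1)
  lie_J_J : ∀ m n : ℤ, ⁅J m, J n⁆ = ((n : ℂ) - m) • L (m + n + 2) + (C * cocycleJ m n) • 1

theorem isVirasoroPair_bg_heis {r : Fin 2} {α αs : Fin 2 → ℤ → Module.End ℂ V} {κ ν : ℂ}
    {β β₁ : ℤ → Module.End ℂ V} (H : IsBetaGamma r α αs) (K : IsHeisenberg κ β β₁) (hκ : κ ≠ 0)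
    (hν : ν ^ 2 = 1 / (4 * κ ^ 2))
    (h₁ : ∀ i k l, ⁅α i k, β l⁆ = 0) (h₂ : ∀ i k l, ⁅α i k, β₁ l⁆ = 0)
    (h₃ : ∀ i k l, ⁅αs i k, β l⁆ = 0) (h₄ : ∀ i k l, ⁅αs i k, β₁ l⁆ = 0) :
    IsVirasoroPair (-(1 / 3) * ((if r = 0 then 1 else 0) + 1 / 2))
      (fun n => bgL r α αs n + heisL κ β β₁ n) (fun n => bgJ r α αs n + heisJ ν β β₁ n) := by
  have c₀₀ : ∀ i j s t m n, ⁅powNormal r (α i) (αs j) s m, powNormal 0 β β t n⁆ = 0 :=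
    fun i j s t m n => lie_wNormal_wNormal_eq_zero (H.adm 0 i j) (K.adm₀₀ 0) (h₁ i) (h₁ i)
      (h₃ j) (h₃ j) _ _ _ _
  have c₀₁ : ∀ i j s t m n, ⁅powNormal r (α i) (αs j) s m, powNormal 0 β β₁ t n⁆ = 0 :=
    fun i j s t m n => lie_wNormal_wNormal_eq_zero (H.adm 0 i j) (K.adm₀₁ 0) (h₁ i) (h₂ i)
      (h₃ j) (h₄ j) _ _ _ _
  have c₁₁ : ∀ i j s t m n, ⁅powNormal r (α i) (αs j) s m, powNormal 0 β₁ β₁ t n⁆ = 0 :=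
    fun i j s t m n => lie_wNormal_wNormal_eq_zero (H.adm 0 i j) (K.adm₁₁ 0) (h₂ i) (h₂ i)
      (h₄ j) (h₄ j) _ _ _ _
  have hLL : ∀ m n, ⁅bgL r α αs m, heisL κ β β₁ n⁆ = 0 := fun m n => by
    simp only [bgL, linNormal, heisL, add_lie, lie_add, smul_lie, lie_smul, c₀₀, c₁₁, smul_zero,
      add_zero]
  have hLJ : ∀ m n, ⁅bgL r α αs m, heisJ ν β β₁ n⁆ = 0 := fun m n => by
    simp only [bgL, linNormal, heisJ, add_lie, smul_lie, lie_smul, c₀₁, smul_zero,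
      add_zero]
  have hJL : ∀ m n, ⁅bgJ r α αs m, heisL κ β β₁ n⁆ = 0 := fun m n => by
    simp only [bgJ, linNormal, heisL, add_lie, lie_add, smul_lie, lie_smul, c₀₀, c₁₁, smul_zero,
      add_zero]
  have hJJ : ∀ m n, ⁅bgJ r α αs m, heisJ ν β β₁ n⁆ = 0 := fun m n => by
    simp only [bgJ, linNormal, heisJ, add_lie, smul_lie, lie_smul, c₀₁, smul_zero,
      add_zero]
  have hLL' : ∀ m n, ⁅heisL κ β β₁ m, bgL r α αs n⁆ = 0 := fun m n => by
    rw [← lie_skew, hLL, neg_zero]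
  have hLJ' : ∀ m n, ⁅heisL κ β β₁ m, bgJ r α αs n⁆ = 0 := fun m n => by
    rw [← lie_skew, hJL, neg_zero]
  have hJJ' : ∀ m n, ⁅heisJ ν β β₁ m, bgJ r α αs n⁆ = 0 := fun m n => by
    rw [← lie_skew, hJJ, neg_zero]
  refine ⟨fun m n => ?_, fun m n => ?_, fun m n => ?_⟩
  · simp only [add_lie, lie_add, hLL, hLL', H.lie_bgL_bgL, K.lie_heisL_heisL hκ]
    module
  · simp only [add_lie, lie_add, hLJ, hLJ', H.lie_bgL_bgJ, K.lie_heisL_heisJ hκ]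
    module
  · simp only [add_lie, lie_add, hJJ, hJJ', H.lie_bgJ_bgJ, K.lie_heisJ_heisJ hκ hν]
    module

/-! ### From field relations to representations of the 3-point Virasoro algebra -/

/-- The exponent of `z` which belongs to `d̄_{n-1} = -d_n` is `-n - 1`. -/
theorem cocycleL_eq (m n : ℤ) :
    cocycleL (-m - 1) (-n - 1) = phi₁Basis (.inl m) (.inl n) := by
  have e0 : (-m - 1 + (-n - 1) = 0) ↔ (m + n = -2) := by omega
  have e1 : (-m - 1 + (-n - 1) = -1) ↔ (m + n = -1) := by omega
  have e2 : (-m - 1 + (-n - 1) = -2) ↔ (m + n = 0) := by omega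
  simp only [cocycleL, phi₁Basis, e0, e1, e2]
  push_cast
  ring

theorem cocycleJ_eq (m n : ℤ) :
    cocycleJ (-m - 1) (-n - 1) = phi₁Basis (.inr m) (.inr n) := by
  have e1 : (-m - 1 + (-n - 1) = -3) ↔ (m + n = 1) := by omega
  have e2 : (-m - 1 + (-n - 1) = -2) ↔ (m + n = 0) := by omega
  simp only [cocycleJ, phi₁Basis, e1, e2]
  push_cast
  ring

/-- The linear map on the Witt algebra with `d_n ↦ -L_{-n-1}` and `d¹_n ↦ -J_{-n-1}`. -/
def wittMap (L J : ℤ → Module.End ℂ V) : Witt →ₗ[ℂ] Module.End ℂ V :=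
  wittBasis.constr ℂ (Sum.elim (fun n => -L (-n - 1)) (fun n => -J (-n - 1)))

theorem wittMap_d (L J : ℤ → Module.End ℂ V) (n : ℤ) : wittMap L J (d n) = -L (-n - 1) := by
  rw [← wittBasis_inl, wittMap, Module.Basis.constr_basis, Sum.elim_inl]

theorem wittMap_d1 (L J : ℤ → Module.End ℂ V) (n : ℤ) : wittMap L J (d1 n) = -J (-n - 1) := by
  rw [← wittBasis_inr, wittMap, Module.Basis.constr_basis, Sum.elim_inr]

/-- The second coordinate on the centre. -/
def centreSnd : Centre →ₗ[ℂ] ℂ :=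
  LinearMap.snd ℂ ℂ ℂ ∘ₗ (TrivialLieModule.equiv ℂ Witt (ℂ × ℂ)).toLinearMap

theorem centreSnd_symm (a b : ℂ) :
    centreSnd ((TrivialLieModule.equiv ℂ Witt (ℂ × ℂ)).symm (a, b)) = b := by
  simp [centreSnd]

theorem IsVirasoroPair.wittMap_lie {C : ℂ} {L J : ℤ → Module.End ℂ V}
    (H : IsVirasoroPair C L J) (x y : Witt) :
    wittMap L J ⁅x, y⁆ + (-(C / 2) * centreSnd (cocycleBilin x y)) • 1 =
      ⁅wittMap L J x, wittMap L J y⁆ := by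
  let F : Witt →ₗ[ℂ] Witt →ₗ[ℂ] Module.End ℂ V := LinearMap.mk₂ ℂ
    (fun x y => wittMap L J ⁅x, y⁆ + (-(C / 2) * centreSnd (cocycleBilin x y)) • 1)
    (fun x x' y => by
      have h : ⁅x + x', y⁆ = ⁅x, y⁆ + ⁅x', y⁆ := add_lie x x' y
      rw [h, map_add, map_add, LinearMap.add_apply, map_add]; module)
    (fun c x y => by
      have h : ⁅c • x, y⁆ = c • ⁅x, y⁆ := smul_lie c x y
      rw [h, map_smul, map_smul, LinearMap.smul_apply, map_smul, smul_eq_mul]; module)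
    (fun x y y' => by
      have h : ⁅x, y + y'⁆ = ⁅x, y⁆ + ⁅x, y'⁆ := lie_add x y y'
      rw [h, map_add, map_add, map_add]; module)
    (fun c x y => by
      have h : ⁅x, c • y⁆ = c • ⁅x, y⁆ := lie_smul c x y
      rw [h, map_smul, map_smul, map_smul, smul_eq_mul]; module)
  let G : Witt →ₗ[ℂ] Witt →ₗ[ℂ] Module.End ℂ V := LinearMap.mk₂ ℂ
    (fun x y => ⁅wittMap L J x, wittMap L J y⁆)
    (fun x x' y => by simp only [add_lie, map_add])
    (fun c x y => by simp only [smul_lie, map_smul])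
    (fun x y y' => by simp only [lie_add, map_add])
    (fun c x y => by simp only [lie_smul, map_smul])
  have key : F = G := by
    refine wittBasis.ext fun i => wittBasis.ext fun j => ?_
    simp only [F, G, LinearMap.mk₂_apply, cocycleBilin_basis, centreSnd_symm]
    rcases i with m | m <;> rcases j with n | n <;> simp only [wittBasis_inl, wittBasis_inr]
    · simp only [lie_d_d, map_smul, map_add, wittMap_d, neg_lie, lie_neg, H.lie_L_L, cocycleL_eq,
        phi₂Basis, show -(m + n + 1) - 1 = -m - 1 + (-n - 1) by ring,
        show -m - 1 + (-n - 1) + 1 = -(m + n) - 1 by ring]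
      push_cast
      module
    · simp only [lie_d_d1, map_smul, map_add, wittMap_d, wittMap_d1, neg_lie, lie_neg, H.lie_L_J,
        phi₂Basis, show -(m + n + 1) - 1 = -m - 1 + (-n - 1) by ring,
        show -m - 1 + (-n - 1) + 1 = -(m + n) - 1 by ring]
      push_cast
      module
    · rw [← lie_skew (wittMap L J (d1 m))]
      simp only [lie_d1_d, map_smul, map_add, map_neg, wittMap_d, wittMap_d1, neg_lie, lie_neg,
        H.lie_L_J, phi₂Basis, show -(n + m + 1) - 1 = -n - 1 + (-m - 1) by ring,
        show -n - 1 + (-m - 1) + 1 = -(n + m) - 1 by ring]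
      push_cast
      module
    · simp only [lie_d1_d1, map_smul, wittMap_d, wittMap_d1, neg_lie, lie_neg, H.lie_J_J,
        cocycleJ_eq, phi₂Basis, show -(m + n - 1) - 1 = -m - 1 + (-n - 1) + 2 by ring]
      push_cast
      module
  exact congrArg (fun B : Witt →ₗ[ℂ] Witt →ₗ[ℂ] Module.End ℂ V => B x y) key

/-- The inclusion of the Witt algebra as a linear complement of the centre. -/
def ofWitt : Witt →ₗ[ℂ] Virasoro where
  toFun x := Virasoro.of x 0 0
  map_add' x y := by
    change LieAlgebra.ofProd _ _ = LieAlgebra.ofProd _ _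
    congr 1
    exact Prod.ext rfl (by simp [Virasoro.of])
  map_smul' c x := by
    change LieAlgebra.ofProd _ _ = LieAlgebra.ofProd _ _
    congr 1
    refine Prod.ext rfl ?_
    change (TrivialLieModule.equiv ℂ Witt (ℂ × ℂ)).symm (0, 0) =
      c • (TrivialLieModule.equiv ℂ Witt (ℂ × ℂ)).symm (0, 0)
    rw [← map_smul, Prod.smul_mk, smul_zero]

theorem eq_ofWitt_add (y : Virasoro) : ∃ (x : Witt) (a b : ℂ),
    y = ofWitt x + a • c₁ + b • c₂ := by
  obtain ⟨⟨x, z⟩, rfl⟩ := (LieAlgebra.ofProd (⟨cochain, cochain_mem⟩ :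
    LieModule.Cohomology.twoCocycle ℂ Witt Centre)).surjective y
  obtain ⟨⟨a, b⟩, rfl⟩ := (TrivialLieModule.equiv ℂ Witt (ℂ × ℂ)).symm.surjective z
  refine ⟨x, a, b, ?_⟩
  change LieAlgebra.ofProd _ _ = LieAlgebra.ofProd _ ((_, _) + a • (_, _) + b • (_, _))
  rw [Prod.smul_mk, Prod.smul_mk, Prod.mk_add_mk, Prod.mk_add_mk, ← map_smul, ← map_smul,
    ← map_add, ← map_add]
  simp

/-- The component of an element of the Virasoro algebra in the Witt algebra. -/
def wittPart : Virasoro →ₗ[ℂ] Witt where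
  toFun y := ((LieAlgebra.ofProd (⟨cochain, cochain_mem⟩ :
    LieModule.Cohomology.twoCocycle ℂ Witt Centre)).symm y).1
  map_add' _ _ := rfl
  map_smul' _ _ := rfl

/-- The component of an element of the Virasoro algebra in the centre. -/
def centrePart : Virasoro →ₗ[ℂ] Centre where
  toFun y := ((LieAlgebra.ofProd (⟨cochain, cochain_mem⟩ :
    LieModule.Cohomology.twoCocycle ℂ Witt Centre)).symm y).2
  map_add' _ _ := rfl
  map_smul' _ _ := rfl

theorem wittPart_lie (y y' : Virasoro) : wittPart ⁅y, y'⁆ = ⁅wittPart y, wittPart y'⁆ := rfl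

theorem centrePart_lie (y y' : Virasoro) :
    centrePart ⁅y, y'⁆ = cocycleBilin (wittPart y) (wittPart y') := by
  change cocycleBilin (wittPart y) (wittPart y') + ⁅wittPart y, centrePart y'⁆ -
    ⁅wittPart y', centrePart y⁆ = _
  rw [trivial_lie_zero, trivial_lie_zero, add_zero, sub_zero]

/-- The linear map `x + a₁ c₁ + a₂ c₂ ↦ wittMap x - (C / 2) a₂`. -/
def repMap (C : ℂ) (L J : ℤ → Module.End ℂ V) : Virasoro →ₗ[ℂ] Module.End ℂ V :=
  wittMap L J ∘ₗ wittPart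
    + ((-(C / 2)) • (centreSnd ∘ₗ centrePart)).smulRight (1 : Module.End ℂ V)

theorem repMap_apply (C : ℂ) (L J : ℤ → Module.End ℂ V) (y : Virasoro) :
    repMap C L J y =
      wittMap L J (wittPart y) + (-(C / 2) * centreSnd (centrePart y)) • (1 : Module.End ℂ V) := by
  simp only [repMap, LinearMap.add_apply, LinearMap.comp_apply, LinearMap.smulRight_apply,
    LinearMap.smul_apply, smul_eq_mul]

theorem lie_add_smul_one (x y : Module.End ℂ V) (a b : ℂ) :
    ⁅x + a • (1 : Module.End ℂ V), y + b • (1 : Module.End ℂ V)⁆ = ⁅x, y⁆ := by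
  have h1 : ∀ x : Module.End ℂ V, ⁅x, (1 : Module.End ℂ V)⁆ = 0 := fun x => by
    simp [Ring.lie_def]
  have h2 : ∀ x : Module.End ℂ V, ⁅(1 : Module.End ℂ V), x⁆ = 0 := fun x => by
    simp [Ring.lie_def]
  rw [add_lie, lie_add, smul_lie, lie_smul, h1, h2, smul_zero, smul_zero, add_zero, add_zero]

theorem IsVirasoroPair.repMap_lie {C : ℂ} {L J : ℤ → Module.End ℂ V} (H : IsVirasoroPair C L J)
    (y y' : Virasoro) : repMap C L J ⁅y, y'⁆ = ⁅repMap C L J y, repMap C L J y'⁆ := by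
  have e := repMap_apply C L J ⁅y, y'⁆
  rw [wittPart_lie y y', centrePart_lie y y'] at e
  rw [e, repMap_apply C L J y, repMap_apply C L J y', lie_add_smul_one]
  exact H.wittMap_lie (wittPart y) (wittPart y')

/-- The representation attached to a pair of fields. -/
def IsVirasoroPair.rep {C : ℂ} {L J : ℤ → Module.End ℂ V} (H : IsVirasoroPair C L J) :
    Virasoro →ₗ⁅ℂ⁆ Module.End ℂ V :=
  { repMap C L J with map_lie' := fun {y y'} => H.repMap_lie y y' }

theorem wittPart_of (x : Witt) (a b : ℂ) : wittPart (Virasoro.of x a b) = x := rfl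

theorem centrePart_of (x : Witt) (a b : ℂ) : centrePart (Virasoro.of x a b) =
    (TrivialLieModule.equiv ℂ Witt (ℂ × ℂ)).symm (a, b) := rfl

theorem repMap_of (C : ℂ) (L J : ℤ → Module.End ℂ V) (x : Witt) (a b : ℂ) :
    repMap C L J (Virasoro.of x a b) = wittMap L J x + (-(C / 2) * b) • 1 := by
  rw [repMap_apply, wittPart_of, centrePart_of, centreSnd_symm]

/-- A linear map on the Virasoro algebra is determined by its values on `d̄_m`, `d̄¹_m`, `c̄`
and `c₁`. -/
theorem eq_repMap {C : ℂ} {L J : ℤ → Module.End ℂ V} {T : Virasoro →ₗ[ℂ] Module.End ℂ V}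
    (hL : ∀ m, T (dBar m) = L (-m - 2)) (hJ : ∀ m, T (d1Bar m) = J (-m - 2))
    (hC : T cBar = C • 1) (h0 : T c₁ = 0) : T = repMap C L J := by
  have hL' : ∀ m, T (ofWitt (d m)) = -L (-m - 1) := fun m => by
    have h := hL (m - 1)
    rw [dBar, map_neg, sub_add_cancel, show -(m - 1) - 2 = -m - 1 by ring] at h
    rw [← h, neg_neg]
    rfl
  have hJ' : ∀ m, T (ofWitt (d1 m)) = -J (-m - 1) := fun m => by
    have h := hJ (m - 1)
    rw [d1Bar, map_neg, sub_add_cancel, show -(m - 1) - 2 = -m - 1 by ring] at h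
    rw [← h, neg_neg]
    rfl
  have hW : T ∘ₗ ofWitt = wittMap L J := by
    refine wittBasis.ext fun i => ?_
    rcases i with m | m
    · rw [wittBasis_inl, wittMap_d]; exact hL' m
    · rw [wittBasis_inr, wittMap_d1]; exact hJ' m
  have hc₂ : T c₂ = (-(C / 2)) • 1 := by
    -- `c₂ = (c₁ - c̄) / 2`, where `c₁` acts by zero.
    rw [cBar, map_sub, map_smul, h0, zero_sub] at hC
    have : T c₂ = (-(1 / 2) : ℂ) • -((2 : ℂ) • T c₂) := by module
    rw [this, hC]
    module
  refine LinearMap.ext fun y => ?_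
  obtain ⟨x, a, b, rfl⟩ := eq_ofWitt_add y
  have hx : T (ofWitt x) = wittMap L J x :=
    congrArg (fun f : Witt →ₗ[ℂ] Module.End ℂ V => f x) hW
  have hx' : repMap C L J (ofWitt x) = wittMap L J x := (repMap_of C L J x 0 0).trans (by simp)
  have h0' : repMap C L J c₁ = 0 := (repMap_of C L J 0 1 0).trans (by simp)
  have hc₂' : repMap C L J c₂ = (-(C / 2)) • 1 := (repMap_of C L J 0 0 1).trans (by simp)
  have expand : ∀ S : Virasoro →ₗ[ℂ] Module.End ℂ V,
      S (ofWitt x + a • c₁ + b • c₂) = S (ofWitt x) + a • S c₁ + b • S c₂ := fun S =>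
    (S.map_add _ _).trans (congrArg₂ (· + ·) ((S.map_add _ _).trans
      (congrArg₂ (· + ·) rfl (S.map_smul _ _))) (S.map_smul _ _))
  rw [expand, expand, hx, hx', h0, h0', hc₂, hc₂']

theorem IsVirasoroPair.existsUnique_rep {C : ℂ} {L J : ℤ → Module.End ℂ V}
    (H : IsVirasoroPair C L J) :
    ∃! ρ : Virasoro →ₗ⁅ℂ⁆ Module.End ℂ V,
      (∀ m : ℤ, ρ (dBar m) = L (-m - 2)) ∧ (∀ m : ℤ, ρ (d1Bar m) = J (-m - 2)) ∧
        ρ cBar = C • 1 ∧ ρ c₁ = 0 := by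
  refine ⟨H.rep, ⟨fun m => ?_, fun m => ?_, ?_, ?_⟩, ?_⟩
  · change repMap C L J (dBar m) = _
    rw [dBar, map_neg, repMap_of, wittMap_d, show -(m + 1) - 1 = -m - 2 by ring]
    simp
  · change repMap C L J (d1Bar m) = _
    rw [d1Bar, map_neg, repMap_of, wittMap_d1, show -(m + 1) - 1 = -m - 2 by ring]
    simp
  · change repMap C L J cBar = _
    rw [cBar, map_sub, map_smul, c₁, c₂, repMap_of, repMap_of, map_zero]
    module
  · change repMap C L J c₁ = _
    rw [c₁, repMap_of, map_zero]
    simp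
  · rintro ρ ⟨hL, hJ, hC, h0⟩
    have h := eq_repMap (T := (ρ : Virasoro →ₗ[ℂ] Module.End ℂ V)) hL hJ hC h0
    exact LieHom.ext fun y => congrArg (fun f : Virasoro →ₗ[ℂ] Module.End ℂ V => f y) h

/-! ### Canonical commutation relations -/

/-- The relations of the multiplications `M i` by variables and of the partial derivatives `D i`,
where only finitely many of the latter act non-trivially on any given vector. -/
structure IsCCR {σ : Type} [DecidableEq σ] (M D : σ → Module.End ℂ V) : Prop where
  mul_mul : ∀ i j v, M i (M j v) = M j (M i v)
  der_der : ∀ i j v, D i (D j v) = D j (D i v)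
  der_mul : ∀ i j v, D i (M j v) = M j (D i v) + if i = j then v else 0
  finite : ∀ v, {i | D i v ≠ 0}.Finite

theorem pderiv_pderiv_comm {σ : Type} (i j : σ) (p : MvPolynomial σ ℂ) :
    MvPolynomial.pderiv i (MvPolynomial.pderiv j p) =
      MvPolynomial.pderiv j (MvPolynomial.pderiv i p) := by
  classical
  have h : ⁅MvPolynomial.pderiv (R := ℂ) i, MvPolynomial.pderiv (R := ℂ) j⁆ = 0 := by
    refine MvPolynomial.derivation_ext fun k => ?_
    simp [Derivation.commutator_apply, MvPolynomial.pderiv_X, Pi.single_apply, apply_ite]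
  have h' := congrArg (fun δ => δ p) h
  simpa [Derivation.commutator_apply, sub_eq_zero] using h'

theorem pderiv_X_mul {σ : Type} [DecidableEq σ] (i j : σ) (p : MvPolynomial σ ℂ) :
    MvPolynomial.pderiv i (MvPolynomial.X j * p) =
      MvPolynomial.X j * MvPolynomial.pderiv i p + if i = j then p else 0 := by
  rw [Derivation.leibniz, MvPolynomial.pderiv_X, smul_eq_mul]
  by_cases hij : i = j
  · subst hij; simp
  · simp [hij, Ne.symm hij]

theorem isCCR_mvPolynomial (σ : Type) [DecidableEq σ] :
    IsCCR (V := MvPolynomial σ ℂ) (fun i : σ => mulVar i) (fun i => derVar i) where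
  mul_mul i j v := mul_left_comm (MvPolynomial.X i) (MvPolynomial.X j) v
  der_der i j v := pderiv_pderiv_comm i j v
  der_mul i j v := pderiv_X_mul i j v
  finite v := v.vars.finite_toSet.subset fun i hi => by
    by_contra hc
    exact hi (MvPolynomial.pderiv_eq_zero_of_notMem_vars hc)

theorem finite_der_ne_zero_add {σ : Type} {D : σ → Module.End ℂ V} {v w : V}
    (hv : {i | D i v ≠ 0}.Finite) (hw : {i | D i w ≠ 0}.Finite) :
    {i | D i (v + w) ≠ 0}.Finite := by
  refine (hv.union hw).subset fun i hi => ?_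
  by_contra hc
  simp only [Set.mem_union, Set.mem_ofPred_eq, not_or, not_not] at hc
  exact hi (by rw [map_add, hc.1, hc.2, add_zero])

open scoped TensorProduct

namespace IsCCR

variable {σ : Type} [DecidableEq σ] {M D : σ → Module.End ℂ V}

theorem rTensor (H : IsCCR M D) (W : Type*) [AddCommGroup W] [Module ℂ W] :
    IsCCR (V := V ⊗[ℂ] W) (fun i => (M i).rTensor W) (fun i => (D i).rTensor W) where
  mul_mul i j v := by
    induction v with
    | zero => simp
    | tmul x y => simp [H.mul_mul i j]
    | add x y hx hy => simp only [map_add, hx, hy]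
  der_der i j v := by
    induction v with
    | zero => simp
    | tmul x y => simp [H.der_der i j]
    | add x y hx hy => simp only [map_add, hx, hy]
  der_mul i j v := by
    induction v with
    | zero => simp
    | tmul x y => by_cases hij : i = j <;> simp [H.der_mul, hij, TensorProduct.add_tmul]
    | add x y hx hy =>
      simp only [map_add, hx, hy]
      by_cases hij : i = j <;> simp only [hij, if_true, if_false, add_zero]
      abel
  finite v := by
    induction v with
    | zero => simp
    | tmul x y =>
      refine (H.finite x).subset fun i hi h => hi ?_
      rw [LinearMap.rTensor_tmul, h, TensorProduct.zero_tmul]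
    | add x y hx hy => exact finite_der_ne_zero_add hx hy

theorem lTensor (H : IsCCR M D) (W : Type*) [AddCommGroup W] [Module ℂ W] :
    IsCCR (V := W ⊗[ℂ] V) (fun i => (M i).lTensor W) (fun i => (D i).lTensor W) where
  mul_mul i j v := by
    induction v with
    | zero => simp
    | tmul x y => simp [H.mul_mul i j]
    | add x y hx hy => simp only [map_add, hx, hy]
  der_der i j v := by
    induction v with
    | zero => simp
    | tmul x y => simp [H.der_der i j]
    | add x y hx hy => simp only [map_add, hx, hy]
  der_mul i j v := by
    induction v with
    | zero => simp
    | tmul x y => by_cases hij : i = j <;> simp [H.der_mul, hij, TensorProduct.tmul_add]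
    | add x y hx hy =>
      simp only [map_add, hx, hy]
      by_cases hij : i = j <;> simp only [hij, if_true, if_false, add_zero]
      abel
  finite v := by
    induction v with
    | zero => simp
    | tmul x y =>
      refine (H.finite y).subset fun i hi h => hi ?_
      rw [LinearMap.lTensor_tmul, h, TensorProduct.tmul_zero]
    | add x y hx hy => exact finite_der_ne_zero_add hx hy

theorem lie_mul_mul (H : IsCCR M D) (i j : σ) : ⁅M i, M j⁆ = 0 :=
  LinearMap.ext fun v => sub_eq_zero.2 (H.mul_mul i j v)

theorem lie_der_der (H : IsCCR M D) (i j : σ) : ⁅D i, D j⁆ = 0 :=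
  LinearMap.ext fun v => sub_eq_zero.2 (H.der_der i j v)

theorem lie_der_mul (H : IsCCR M D) (i j : σ) :
    ⁅D i, M j⁆ = (if i = j then 1 else 0 : ℂ) • 1 := by
  refine LinearMap.ext fun v => ?_
  rw [Ring.lie_def, LinearMap.sub_apply, Module.End.mul_apply, Module.End.mul_apply, H.der_mul,
    add_sub_cancel_left]
  by_cases hij : i = j <;> simp [hij]

theorem lie_mul_der (H : IsCCR M D) (i j : σ) :
    ⁅M i, D j⁆ = (if j = i then -1 else 0 : ℂ) • 1 := by
  rw [← lie_skew, H.lie_der_mul, ← neg_smul]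
  by_cases hij : j = i <;> simp [hij]

/-- For `r = 0` the coefficients of negative powers of `z` are derivatives, for `α` as well as for
`α*`. For `r = 1` all coefficients of `α` are variables and all those of `α*` are derivatives, of
which only finitely many act non-trivially on a given vector. -/
theorem isBetaGamma {M D : Fin 2 × ℤ → Module.End ℂ V} (H : IsCCR M D) {r : Fin 2}
    {α αs : Fin 2 → ℤ → Module.End ℂ V}
    (hα : ∀ i k, α i k = if 0 ≤ -k - 1 ∧ r = 0 then D (i, -k - 1) else M (i, -k - 1))
    (hαs : ∀ i k, αs i k = if -k ≤ 0 ∧ r = 0 then M (i, - -k) else -D (i, - -k)) :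
    IsBetaGamma r α αs where
  adm c i j := by
    have inj₁ : Function.Injective fun k : ℤ => (i, -k - 1) := fun a b h => by
      simpa using h
    have inj₂ : ∀ n : ℤ, Function.Injective fun k : ℤ => (j, n - k) := fun n a b h => by
      simpa using h
    refine ⟨fun v => ?_, fun v n => ?_⟩
    · refine ((Set.finite_Ico 0 c).union ((H.finite v).preimage inj₁.injOn)).subset
        fun k hk => ?_
      obtain ⟨⟨hr, hkc⟩, hk0⟩ := hk
      by_cases hk : 0 ≤ k
      · exact Or.inl ⟨hk, hkc⟩
      · refine Or.inr ?_
        rwa [hα, if_pos ⟨by omega, hr⟩] at hk0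
    · refine ((Set.finite_Icc c n).union ((H.finite v).preimage (inj₂ n).injOn)).subset
        fun k hk => ?_
      obtain ⟨hkc, hk0⟩ := hk
      by_cases hcond : -(n - k) ≤ 0 ∧ r = 0
      · have : ¬ k < c := fun h => hkc ⟨hcond.2, h⟩
        exact Or.inl ⟨by omega, by omega⟩
      · refine Or.inr fun h => hk0 ?_
        rw [hαs, if_neg hcond, neg_neg, LinearMap.neg_apply, h, neg_zero]
  lie_left i j k l := by
    rw [hα, hα]
    split_ifs with h1 h2 h2
    · exact H.lie_der_der _ _
    · rw [H.lie_der_mul, if_neg, zero_smul]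
      rw [Prod.mk.injEq]
      omega
    · rw [H.lie_mul_der, if_neg, zero_smul]
      rw [Prod.mk.injEq]
      omega
    · exact H.lie_mul_mul _ _
  lie_right i j k l := by
    rw [hαs, hαs]
    split_ifs with h1 h2 h2
    · exact H.lie_mul_mul _ _
    · rw [lie_neg, H.lie_mul_der, if_neg, zero_smul, neg_zero]
      rw [Prod.mk.injEq]
      omega
    · rw [neg_lie, H.lie_der_mul, if_neg, zero_smul, neg_zero]
      rw [Prod.mk.injEq]
      omega
    · rw [neg_lie, lie_neg, H.lie_der_der, neg_zero, neg_zero]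
  lie_mixed i j k l := by
    have hiff : ((i, -k - 1) = (j, - -l)) ↔ (l = -1 - k ∧ i = j) := by
      rw [Prod.mk.injEq]
      omega
    rw [hα, hαs, ← ite_and]
    split_ifs with h1 h2 h3 h3 h2 h3 h3
    · rw [H.lie_der_mul, if_pos (hiff.2 h3)]
    · rw [H.lie_der_mul, if_neg (fun h => h3 (hiff.1 h))]
    · omega
    · rw [lie_neg, H.lie_der_der, neg_zero, zero_smul]
    · omega
    · rw [H.lie_mul_mul, zero_smul]
    · rw [lie_neg, H.lie_mul_der, if_pos (hiff.2 h3).symm]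
      module
    · rw [lie_neg, H.lie_mul_der, if_neg (fun h => h3 (hiff.1 h.symm))]
      module

end IsCCR

theorem admissible_of_finite {A B : ℤ → Module.End ℂ V}
    (hA : ∀ v c, {k | k < c ∧ A k v ≠ 0}.Finite) (hB : ∀ v c, {k | k < c ∧ B k v ≠ 0}.Finite)
    (c : ℤ) : Admissible (cut 0 c) A B where
  left v := (hA v c).subset fun k hk => ⟨hk.1.2, hk.2⟩
  right v n := by
    refine ((hB v (n - c + 1)).preimage (sub_right_injective (b := n)).injOn).subset fun k hk => ?_
    have : ¬ k < c := fun h => hk.1 ⟨rfl, h⟩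
    exact ⟨show n - k < n - c + 1 by omega, hk.2⟩

namespace IsCCR

variable {M D : Fin 2 × {n : ℤ // n < 0} → Module.End ℂ V}

theorem finite_index (H : IsCCR M D) (i : Fin 2) (v : V) :
    {n : ℤ | ∃ h : n < 0, D (i, ⟨n, h⟩) v ≠ 0}.Finite :=
  ((H.finite v).image fun p => p.2.1).subset fun n hn => ⟨(i, ⟨n, hn.1⟩), hn.2, rfl⟩

/-- The operator `N` is the part of `b¹_0` which acts on the third factor of the Fock space. -/
theorem isHeisenberg (H : IsCCR M D) {N : Module.End ℂ V} (hMN : ∀ i, ⁅M i, N⁆ = 0)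
    (hDN : ∀ i, ⁅D i, N⁆ = 0) {κ B₀ : ℂ} {β β₁ : ℤ → Module.End ℂ V} {b b₁ : ℤ → Module.End ℂ V}
    (hβ : ∀ k, β k = b (-k - 1)) (hβ₁ : ∀ k, β₁ k = b₁ (-k - 1))
    (hb : ∀ n, b n = if hn : n < 0 then M (0, ⟨n, hn⟩)
      else if hp : 0 < n then (-2 * n * κ) • D (0, ⟨-n, by omega⟩) else B₀ • 1)
    (hb₁ : ∀ n, b₁ n = if hn : n < 0 then M (1, ⟨n, hn⟩)
      else (-(2 + 2 * n) * κ) • D (1, ⟨-2 - n, by omega⟩)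
        + (-4 * (1 + 2 * n) * κ) • D (1, ⟨-1 - n, by omega⟩) + if n = 0 then N else 0) :
    IsHeisenberg κ β β₁ := by
  have β_ann : ∀ k (h : k < -1), β k = (2 * (k + 1) * κ) • D (0, ⟨k + 1, by omega⟩) := by
    intro k h
    rw [hβ, hb, dif_neg (by omega), dif_pos (by omega)]
    congr 1
    · push_cast; ring
    · simp only [neg_sub, sub_neg_eq_add, add_comm]
  have β_zero : β (-1) = B₀ • 1 := by rw [hβ, hb]; simp
  have β_cre : ∀ k (h : -1 < k), β k = M (0, ⟨-k - 1, by omega⟩) := by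
    intro k h
    rw [hβ, hb, dif_pos (by omega)]
  have β₁_ann : ∀ k (h : k ≤ -1), β₁ k = (2 * k * κ) • D (1, ⟨k - 1, by omega⟩)
      + (4 * (2 * k + 1) * κ) • D (1, ⟨k, by omega⟩) + (if k = -1 then 1 else 0 : ℂ) • N := by
    intro k h
    rw [hβ₁, hb₁, dif_neg (by omega)]
    congr 1
    · congr 2
      · push_cast; ring
      · congr 3; ring
      · push_cast; ring
      · congr 3; ring
    · by_cases hk : k = -1
      · simp [hk]
      · simp [hk, show -k - 1 ≠ 0 by omega]
  have β₁_cre : ∀ k (h : -1 < k), β₁ k = M (1, ⟨-k - 1, by omega⟩) := by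
    intro k h
    rw [hβ₁, hb₁, dif_pos (by omega)]
  -- For exponents below `-1` the modes are combinations of derivatives.
  have fβ : ∀ v c, {k | k < c ∧ β k v ≠ 0}.Finite := fun v c => by
    refine ((Set.finite_Ico (-1) c).union ((H.finite_index 0 v).preimage
      (add_left_injective (1 : ℤ)).injOn)).subset fun k hk => ?_
    obtain ⟨hkc, hk0⟩ := hk
    by_cases h : -1 ≤ k
    · exact Or.inl ⟨h, hkc⟩
    · refine Or.inr ⟨show k + 1 < 0 by omega, fun h0 => hk0 ?_⟩
      rw [β_ann k (by omega), LinearMap.smul_apply]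
      exact (congrArg _ h0).trans (smul_zero _)
  have fβ₁ : ∀ v c, {k | k < c ∧ β₁ k v ≠ 0}.Finite := fun v c => by
    refine ((Set.finite_Ico (-1) c).union (((H.finite_index 1 v).preimage
      (sub_left_injective (b := (1 : ℤ))).injOn).union (H.finite_index 1 v))).subset fun k hk => ?_
    obtain ⟨hkc, hk0⟩ := hk
    by_cases h : -1 ≤ k
    · exact Or.inl ⟨h, hkc⟩
    · refine Or.inr ?_
      by_contra hc
      simp only [Set.mem_union, Set.mem_preimage, Set.mem_ofPred_eq, not_or, not_exists,
        not_not] at hc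
      refine hk0 ?_
      rw [β₁_ann k (by omega), if_neg (by omega), zero_smul, add_zero, LinearMap.add_apply,
        LinearMap.smul_apply, LinearMap.smul_apply, hc.1 (by omega), hc.2 (by omega), smul_zero,
        smul_zero, add_zero]
  have hNM : ∀ i, ⁅N, M i⁆ = 0 := fun i => by rw [← lie_skew, hMN, neg_zero]
  have hND : ∀ i, ⁅N, D i⁆ = 0 := fun i => by rw [← lie_skew, hDN, neg_zero]
  have h1 : ∀ x : Module.End ℂ V, ⁅x, (1 : Module.End ℂ V)⁆ = 0 := fun x => by
    simp [Ring.lie_def]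
  have h2 : ∀ x : Module.End ℂ V, ⁅(1 : Module.End ℂ V), x⁆ = 0 := fun x => by
    simp [Ring.lie_def]
  have i01 : (0 : Fin 2) ≠ 1 := by decide
  refine ⟨admissible_of_finite fβ fβ, admissible_of_finite fβ fβ₁, admissible_of_finite fβ₁ fβ₁,
    fun k l => ?_, fun k l => ?_, fun k l => ?_⟩
  · rcases lt_trichotomy k (-1) with hk | rfl | hk
    · rcases lt_trichotomy l (-1) with hl | rfl | hl
      · rw [β_ann k hk, β_ann l hl, smul_lie, lie_smul, H.lie_der_der, smul_zero, smul_zero,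
          if_neg (by omega), zero_smul]
      · rw [β_zero, lie_smul, h1, smul_zero, if_neg (by omega), zero_smul]
      · rw [β_ann k hk, β_cre l hl, smul_lie, H.lie_der_mul, smul_smul]
        congr 1
        rw [mul_ite, mul_one, mul_zero]
        exact if_congr (by rw [Prod.mk.injEq, Subtype.mk.injEq]; omega) rfl rfl
    · -- Here `b_0` is a scalar, and the stated coefficient `2 * (k + 1) * κ` vanishes.
      rw [β_zero, smul_lie, h2, smul_zero]
      simp
    · rcases lt_trichotomy l (-1) with hl | rfl | hl
      · rw [β_cre k hk, β_ann l hl, lie_smul, H.lie_mul_der, smul_smul]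
        congr 1
        by_cases h : l = -2 - k
        · subst h
          rw [if_pos (by rw [Prod.mk.injEq, Subtype.mk.injEq]; omega), if_pos rfl]
          push_cast; ring
        · rw [if_neg (by rw [Prod.mk.injEq, Subtype.mk.injEq]; omega), if_neg h, mul_zero]
      · rw [β_zero, lie_smul, h1, smul_zero, if_neg (by omega), zero_smul]
      · rw [β_cre k hk, β_cre l hl, H.lie_mul_mul, if_neg (by omega), zero_smul]
  · rcases le_or_gt k (-1) with hk | hk
    · rcases le_or_gt l (-1) with hl | hl
      · rw [β₁_ann k hk, β₁_ann l hl, if_neg (show ¬ l = -k by omega),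
          if_neg (show ¬ l = -1 - k by omega)]
        simp only [lie_add, add_lie, lie_smul, smul_lie, H.lie_der_der, hND, hDN, lie_self,
          smul_zero, zero_smul, add_zero]
      · rw [β₁_ann k hk, β₁_cre l hl]
        simp only [add_lie, smul_lie, H.lie_der_mul, hNM, smul_zero, add_zero, smul_smul, mul_ite,
          mul_one, mul_zero]
        congr 2
        · exact if_congr (by rw [Prod.mk.injEq, Subtype.mk.injEq]; omega) rfl rfl
        · exact if_congr (by rw [Prod.mk.injEq, Subtype.mk.injEq]; omega) rfl rfl
    · rcases le_or_gt l (-1) with hl | hl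
      · rw [β₁_cre k hk, β₁_ann l hl]
        simp only [lie_add, lie_smul, H.lie_mul_der, hMN, smul_zero, add_zero, smul_smul]
        congr 2
        · by_cases h : l = -k
          · subst h
            rw [if_pos (by rw [Prod.mk.injEq, Subtype.mk.injEq]; omega), if_pos rfl]
            push_cast; ring
          · rw [if_neg (by rw [Prod.mk.injEq, Subtype.mk.injEq]; omega), if_neg h, mul_zero]
        · by_cases h : l = -1 - k
          · subst h
            rw [if_pos (by rw [Prod.mk.injEq, Subtype.mk.injEq]; omega), if_pos rfl]
            push_cast; ring
          · rw [if_neg (by rw [Prod.mk.injEq, Subtype.mk.injEq]; omega), if_neg h, mul_zero]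
      · -- The case `k = l = 0` is consistent because the stated coefficient `2 * k * κ` vanishes.
        rw [β₁_cre k hk, β₁_cre l hl, H.lie_mul_mul, if_neg (show ¬ l = -1 - k by omega)]
        by_cases h : l = -k
        · obtain rfl : k = 0 := by omega
          simp
        · rw [if_neg h, zero_smul, add_zero]
  · have hM : ∀ p, ⁅M (0, p), β₁ l⁆ = 0 ∧ ⁅D (0, p), β₁ l⁆ = 0 := by
      intro p
      rcases le_or_gt l (-1) with hl | hl
      · rw [β₁_ann l hl]
        constructor <;>
          simp only [lie_add, lie_smul, H.lie_mul_der, H.lie_der_der, hMN, hDN, Prod.mk.injEq,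
            i01.symm, false_and, if_false, smul_zero, zero_smul, add_zero]
      · rw [β₁_cre l hl]
        constructor <;>
          simp only [H.lie_mul_mul, H.lie_der_mul, Prod.mk.injEq, i01, false_and, if_false,
            zero_smul]
    rcases lt_trichotomy k (-1) with hk | rfl | hk
    · rw [β_ann k hk, smul_lie, (hM _).2, smul_zero]
    · rw [β_zero, smul_lie, h2, smul_zero]
    · rw [β_cre k hk, (hM _).1]

end IsCCR

/-! ### The fields on the Fock space -/

theorem isCCR_onX : IsCCR (V := Fock) (fun i => onX (mulVar i)) (fun i => onX (derVar i)) :=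
  (isCCR_mvPolynomial (Fin 2 × ℤ)).rTensor _

theorem isCCR_onY : IsCCR (V := Fock) (fun i => onY (mulVar i)) (fun i => onY (derVar i)) :=
  ((isCCR_mvPolynomial (Fin 2 × {n : ℤ // n < 0})).rTensor _).lTensor _

theorem lie_eq_zero_of_commute {S T : Module.End ℂ V}
    (h : ∀ v, S (T v) = T (S v)) : ⁅S, T⁆ = 0 :=
  LinearMap.ext fun v => sub_eq_zero.2 (h v)

theorem onX_lTensor (A : Module.End ℂ Cx) (B : Module.End ℂ (Cy ⊗[ℂ] (Fin 2 → ℂ))) (v : Fock) :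
    onX A (B.lTensor _ v) = B.lTensor _ (onX A v) :=
  (congrArg (fun f => f v) (LinearMap.rTensor_comp_lTensor _ A B)).trans
    (congrArg (fun f => f v) (LinearMap.lTensor_comp_rTensor _ A B)).symm

theorem onX_onY (A : Module.End ℂ Cx) (B : Module.End ℂ Cy) (v : Fock) :
    onX A (onY B v) = onY B (onX A v) := onX_lTensor A _ v

theorem onX_onV (A : Module.End ℂ Cx) (B : Module.End ℂ (Fin 2 → ℂ)) (v : Fock) :
    onX A (onV B v) = onV B (onX A v) := onX_lTensor A _ v

theorem onY_onV (A : Module.End ℂ Cy) (B : Module.End ℂ (Fin 2 → ℂ)) (v : Fock) :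
    onY A (onV B v) = onV B (onY A v) := by
  have h : (A.rTensor (Fin 2 → ℂ)) ∘ₗ (B.lTensor Cy) = (B.lTensor Cy) ∘ₗ (A.rTensor (Fin 2 → ℂ)) :=
    (LinearMap.rTensor_comp_lTensor _ A B).trans (LinearMap.lTensor_comp_rTensor _ A B).symm
  have h' := congrArg (fun f => LinearMap.lTensor Cx f v) h
  simp only [LinearMap.lTensor_comp, LinearMap.comp_apply] at h'
  exact h'

theorem isBetaGamma_alpha (r : Fin 2) : IsBetaGamma r (alpha r) (alphaStar r) :=
  isCCR_onX.isBetaGamma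
    (fun i k => by
      change onX (if 0 ≤ -k - 1 ∧ r = 0 then derVar (i, -k - 1) else mulVar (i, -k - 1)) = _
      split_ifs <;> rfl)
    (fun i k => by
      change onX (if -k ≤ 0 ∧ r = 0 then mulVar (i, - -k) else -derVar (i, - -k)) = _
      split_ifs
      · rfl
      · exact LinearMap.rTensor_neg _)

theorem isHeisenberg_beta (κ₀ B₀ : ℂ) (B₁ : Matrix (Fin 2) (Fin 2) ℂ) :
    IsHeisenberg κ₀ (beta κ₀ B₀) (beta1 κ₀ B₁) :=
  isCCR_onY.isHeisenberg (N := onV B₁.vecMulLinear)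
    (fun _ => lie_eq_zero_of_commute (onY_onV _ _))
    (fun _ => lie_eq_zero_of_commute (onY_onV _ _))
    (fun _ => rfl) (fun _ => rfl) (fun _ => rfl) (fun _ => rfl)

theorem onX_beta (A : Module.End ℂ Cx) (κ₀ B₀ : ℂ) (k : ℤ) (v : Fock) :
    onX A (beta κ₀ B₀ k v) = beta κ₀ B₀ k (onX A v) := by
  simp only [beta, bMode]
  split_ifs
  · exact onX_onY _ _ _
  · rw [LinearMap.smul_apply, map_smul, onX_onY, LinearMap.smul_apply]
  · rw [LinearMap.smul_apply, map_smul, LinearMap.smul_apply]; rfl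

theorem onX_beta1 (A : Module.End ℂ Cx) (κ₀ : ℂ) (B₁ : Matrix (Fin 2) (Fin 2) ℂ) (k : ℤ)
    (v : Fock) : onX A (beta1 κ₀ B₁ k v) = beta1 κ₀ B₁ k (onX A v) := by
  simp only [beta1, b1Mode]
  split_ifs
  · exact onX_onY _ _ _
  · simp only [LinearMap.add_apply, LinearMap.smul_apply, map_add, map_smul, onX_onY, onX_onV]
  · simp only [LinearMap.add_apply, LinearMap.smul_apply, map_add, map_smul, onX_onY,
      LinearMap.zero_apply, map_zero]

theorem polyMul_quadratic (a b c : ℂ) (A : Dist) (n : ℤ) :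
    Dist.polyMul (Polynomial.monomial 2 a + Polynomial.monomial 1 b + Polynomial.monomial 0 c) A n =
      a • A (n - 2) + b • A (n - 1) + c • A n := by
  have h0 : ∀ k : ℕ, (0 : ℂ) • A (n - k) = 0 := fun k => zero_smul _ _
  have hadd : ∀ (k : ℕ) (x y : ℂ), (x + y) • A (n - k) = x • A (n - k) + y • A (n - k) :=
    fun k x y => add_smul _ _ _
  rw [Dist.polyMul, Polynomial.sum_add_index _ _ _ h0 hadd, Polynomial.sum_add_index _ _ _ h0 hadd,
    Polynomial.sum_monomial_index _ _ (h0 2), Polynomial.sum_monomial_index _ _ (h0 1),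
    Polynomial.sum_monomial_index _ _ (h0 0)]
  simp

theorem P_eq : P = Polynomial.monomial 2 1 + Polynomial.monomial 1 4 + Polynomial.monomial 0 0 := by
  simp only [P, ← Polynomial.C_mul_X_pow_eq_monomial, map_one, map_zero, Polynomial.C_ofNat]
  ring

theorem C_mul_P_eq (c : ℂ) : Polynomial.C c * P =
    Polynomial.monomial 2 c + Polynomial.monomial 1 (4 * c) + Polynomial.monomial 0 0 := by
  simp only [P, ← Polynomial.C_mul_X_pow_eq_monomial, map_zero, map_mul, Polynomial.C_ofNat]
  ring

theorem half_derivative_P_eq : Polynomial.C (1 / 2) * Polynomial.derivative P =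
    Polynomial.monomial 2 0 + Polynomial.monomial 1 1 + Polynomial.monomial 0 2 := by
  rw [P_eq]
  simp only [map_add, Polynomial.derivative_monomial, mul_add, Polynomial.C_mul_monomial]
  norm_num

theorem C_eq (c : ℂ) : Polynomial.C c =
    Polynomial.monomial 2 0 + Polynomial.monomial 1 0 + Polynomial.monomial 0 c := by
  simp

theorem Admissible.normalSummable {M : Set ℤ} {A B : Dist} (h : Admissible (V := Fock) M A B) :
    Dist.NormalSummable M A B := fun n v => by
  refine (h.finite_support (fun _ => 1) n v).subset fun k hk h0 => hk ?_
  have h1 : normalTerm (V := Fock) M A B n k v = 0 := (one_smul ℂ _).symm.trans h0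
  by_cases hM : k ∈ M
  · simpa [Dist.normalTerm, normalTerm, hM] using h1
  · simpa [Dist.normalTerm, normalTerm, hM] using h1

theorem normalProd_eq_wNormal {M : Set ℤ} {A B : Dist} (h : Admissible (V := Fock) M A B)
    (n : ℤ) : Dist.normalProd M A B n = wNormal (V := Fock) M (fun _ => 1) A B n := by
  refine LinearMap.ext fun v => Eq.trans ?_ (wNormal_apply h _ n v).symm
  rw [Dist.normalProd, dif_pos h.normalSummable]
  refine finsum_congr fun k => Eq.trans ?_ (one_smul ℂ _).symm
  by_cases hM : k ∈ M <;> simp [Dist.normalTerm, normalTerm, hM]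

theorem admissible_alpha (r i j : Fin 2) :
    Admissible (V := Fock) (alphaMinus r) (alpha r i) (alphaStar r j) := by
  rw [alphaMinus_eq_cut]; exact (isBetaGamma_alpha r).adm 0 i j

theorem admissible_alpha_deriv (r i j : Fin 2) :
    Admissible (V := Fock) (alphaMinus r) (alpha r i) (alphaStar r j).deriv :=
  (admissible_alpha r i j).scale_shift_right (fun k => (k : ℂ) + 1) 1

theorem normalProd_alpha (r i j : Fin 2) (n : ℤ) :
    Dist.normalProd (alphaMinus r) (alpha r i) (alphaStar r j) n =
      linNormal (V := Fock) r (alpha r i) (alphaStar r j) 1 0 n := by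
  refine (normalProd_eq_wNormal (admissible_alpha r i j) n).trans ?_
  rw [alphaMinus_eq_cut]
  refine Eq.trans ?_ (wNormal_linear ((isBetaGamma_alpha r).adm 0 i j) 1 0 n)
  congr 1
  funext k
  simp

/-- The derivative turns into an affine weight. -/
theorem normalProd_alpha_deriv (r i j : Fin 2) (n : ℤ) :
    Dist.normalProd (alphaMinus r) (alpha r i) (alphaStar r j).deriv n =
      linNormal (V := Fock) r (alpha r i) (alphaStar r j) (n + 1) (-1) (n + 1) := by
  refine (normalProd_eq_wNormal (admissible_alpha_deriv r i j) n).trans ?_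
  refine (wNormal_scale_shift_right (admissible_alpha r i j) (fun _ => 1)
    (fun k => (k : ℂ) + 1) n 1).trans ?_
  rw [alphaMinus_eq_cut]
  refine Eq.trans ?_ (wNormal_linear ((isBetaGamma_alpha r).adm 0 i j) _ _ _)
  congr 1
  funext k
  push_cast
  ring

theorem normalProd_usual {A B : Dist} (h : Admissible (V := Fock) (cut 0 0) A B) (n : ℤ) :
    Dist.normalProd usual A B n = powNormal (V := Fock) 0 A B 0 n := by
  rw [usual_eq_cut]
  refine (normalProd_eq_wNormal h n).trans ?_
  simp only [powNormal, pow_zero]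

theorem piD_eq (r : Fin 2) (n : ℤ) :
    piD r n = bgL (V := Fock) r (alpha r) (alphaStar r) n := by
  rw [piD, half_derivative_P_eq, P_eq]
  simp only [Pi.add_apply, polyMul_quadratic, normalProd_alpha, normalProd_alpha_deriv]
  rw [show n - 2 + 1 = n - 1 by ring, show n - 1 + 1 = n by ring]
  simp only [bgL, linNormal]
  push_cast
  module

theorem piD1_eq (r : Fin 2) (n : ℤ) :
    piD1 r n = bgJ (V := Fock) r (alpha r) (alphaStar r) n := by
  rw [piD1, half_derivative_P_eq, P_eq]
  simp only [Pi.add_apply, polyMul_quadratic, normalProd_alpha, normalProd_alpha_deriv]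
  rw [show n - 2 + 1 = n - 1 by ring, show n - 1 + 1 = n by ring]
  simp only [bgJ, linNormal]
  push_cast
  module

theorem fieldD_eq (r : Fin 2) (κ₀ B₀ : ℂ) (B₁ : Matrix (Fin 2) (Fin 2) ℂ) (n : ℤ) :
    fieldD r κ₀ B₀ B₁ (Polynomial.C (-1 / (4 * κ₀)) * P) 0 (Polynomial.C (-1 / (4 * κ₀))) 0 n =
      bgL (V := Fock) r (alpha r) (alphaStar r) n
        + heisL (V := Fock) κ₀ (beta κ₀ B₀) (beta1 κ₀ B₁) n := by
  have H := isHeisenberg_beta κ₀ B₀ B₁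
  have hz : ∀ A : Dist, Dist.polyMul 0 A n = 0 := fun A => Polynomial.sum_zero_index _
  rw [fieldD, C_mul_P_eq, C_eq]
  simp only [Pi.add_apply, polyMul_quadratic, hz, piD_eq, normalProd_usual (H.adm₀₀ 0),
    normalProd_usual (H.adm₁₁ 0), heisL]
  module

theorem fieldD1_eq (r : Fin 2) (κ₀ ν B₀ : ℂ) (B₁ : Matrix (Fin 2) (Fin 2) ℂ) (n : ℤ) :
    fieldD1 r κ₀ B₀ B₁ (Polynomial.C ν) 0 n =
      bgJ (V := Fock) r (alpha r) (alphaStar r) n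
        + heisJ (V := Fock) ν (beta κ₀ B₀) (beta1 κ₀ B₁) n := by
  have H := isHeisenberg_beta κ₀ B₀ B₁
  have hz : ∀ A : Dist, Dist.polyMul 0 A n = 0 := fun A => Polynomial.sum_zero_index _
  rw [fieldD1, C_eq]
  simp only [Pi.add_apply, polyMul_quadratic, hz, piD1_eq, normalProd_usual (H.adm₀₁ 0), heisJ]
  module

end
end ThreePoint

theorem mainTheorem1 (r : Fin 2) (κ₀ ν B₀ : ℂ) (B₁ : Matrix (Fin 2) (Fin 2) ℂ)
    (hκ₀ : κ₀ ≠ 0) (hB₁ : B₁ 0 0 = B₁ 1 1) (hν : ν ^ 2 = 1 / (4 * κ₀ ^ 2)) :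
    -- the normal ordered products in the formulas are well defined
    (∀ i j : Fin 2,
      ThreePoint.Dist.NormalSummable (ThreePoint.alphaMinus r)
        (ThreePoint.alpha r i) (ThreePoint.alphaStar r j) ∧
      ThreePoint.Dist.NormalSummable (ThreePoint.alphaMinus r)
        (ThreePoint.alpha r i) (ThreePoint.alphaStar r j).deriv) ∧
    ThreePoint.Dist.NormalSummable ThreePoint.usual
      (ThreePoint.beta κ₀ B₀) (ThreePoint.beta κ₀ B₀) ∧
    ThreePoint.Dist.NormalSummable ThreePoint.usual
      (ThreePoint.beta1 κ₀ B₁) (ThreePoint.beta1 κ₀ B₁) ∧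
    ThreePoint.Dist.NormalSummable ThreePoint.usual
      (ThreePoint.beta κ₀ B₀) (ThreePoint.beta1 κ₀ B₁) ∧
    -- the formulas define a representation
    ∃! ρ : ThreePoint.Virasoro →ₗ⁅ℂ⁆ Module.End ℂ ThreePoint.Fock,
      (∀ m : ℤ, ρ (ThreePoint.dBar m) =
        ThreePoint.fieldD r κ₀ B₀ B₁
          (Polynomial.C (-1 / (4 * κ₀)) * ThreePoint.P) 0
          (Polynomial.C (-1 / (4 * κ₀))) 0 (-m - 2)) ∧
      (∀ m : ℤ, ρ (ThreePoint.d1Bar m) =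
        ThreePoint.fieldD1 r κ₀ B₀ B₁ (Polynomial.C ν) 0 (-m - 2)) ∧
      ρ ThreePoint.cBar = (-(1 / 3) * ((if r = 0 then 1 else 0) + 1 / 2) : ℂ) • 1 ∧
      ρ ThreePoint.c₁ = 0 := by
  have H := ThreePoint.isBetaGamma_alpha r
  have K := ThreePoint.isHeisenberg_beta κ₀ B₀ B₁
  refine ⟨fun i j => ⟨(ThreePoint.admissible_alpha r i j).normalSummable,
    (ThreePoint.admissible_alpha_deriv r i j).normalSummable⟩, ?_, ?_, ?_, ?_⟩
  · rw [ThreePoint.usual_eq_cut]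
    exact (K.adm₀₀ 0).normalSummable
  · rw [ThreePoint.usual_eq_cut]
    exact (K.adm₁₁ 0).normalSummable
  · rw [ThreePoint.usual_eq_cut]
    exact (K.adm₀₁ 0).normalSummable
  · simp only [ThreePoint.fieldD_eq, ThreePoint.fieldD1_eq]
    exact (ThreePoint.isVirasoroPair_bg_heis H K hκ₀ hν
      (fun _ _ _ => ThreePoint.lie_eq_zero_of_commute (ThreePoint.onX_beta _ _ _ _))
      (fun _ _ _ => ThreePoint.lie_eq_zero_of_commute (ThreePoint.onX_beta1 _ _ _ _))
      (fun _ _ _ => ThreePoint.lie_eq_zero_of_commute (ThreePoint.onX_beta _ _ _ _))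
      (fun _ _ _ => ThreePoint.lie_eq_zero_of_commute (ThreePoint.onX_beta1 _ _ _ _))
      ).existsUnique_rep
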